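/- Let $\mathcal H$ be a complex Hilbert space and let $G$ be a selfadjoint unitary operator on $\mathcal H$ such that its eigenspace $\mathcal H_{\rm odd}=\{\xi\in\mathcal H: G\xi=-\xi\}$ is infinite dimensional. Let ${\rm CAR}(\mathcal H)$ be the universal unital $C^*$-algebra generated by elements $a(\varphi)$, $\varphi\in\mathcal H$, such that $\varphi\mapsto a(\varphi)^*$ is linear and $$a(\varphi)^*a(\psi)+a(\psi)a(\varphi)^*=\langle\psi,\varphi\rangle 1,\qquad a(\varphi)a(\psi)+a(\psi)a(\varphi)=0,\qquad \varphi,\psi\in\mathcal H,$$ (inner product linear in the second argument), and let $\gamma_G$ be the involutive $*$-automorphism of ${\rm CAR}(\mathcal H)$ with $\gamma_G(a(\varphi))=a(G\varphi)$. Let ${\rm CAR}(\mathcal H)\rtimes_{\gamma_G}\mathbb Z_2$ be the crossed product, i.e. the $C^*$-algebra ${\rm CAR}(\mathcal H)\oplus{\rm CAR}(\mathcal H)$ with $$(a,b)(a',b')=(aa'+b\gamma_G(b'),\,ab'+b\gamma_G(a')),\qquad (a,b)^*=(a^*,\gamma_G(b^*)),$$ and unit $(1,0)$; let $E(a,b)=a$.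 Then: 1. ${\rm CAR}(\mathcal H)$ has a unique tracial state $\mu_0$. 2. The only linear functional $\tau:{\rm CAR}(\mathcal H)\to\mathbb C$ which is $\gamma_G$-twisted tracial, i.e. $\tau(xy)=\tau(y\,\gamma_G(x))$ for all $x,y$, and dominated by $\mu_0$, i.e. $|\tau(x^*y)|^2\le\mu_0(x^*x)\,\mu_0(y^*y)$ for all $x,y$, is $\tau=0$. 3. There is exactly one tracial state $\omega$ on ${\rm CAR}(\mathcal H)\rtimes_{\gamma_G}\mathbb Z_2$ with $\omega(a,0)=\mu_0(a)$ for all $a$, namely the canonical extension $\omega=\mu_0\circ E$. -/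

import Mathlib

noncomputable section

open scoped TensorProduct ComplexOrder

/-! ### C*-seminorms and the enveloping C*-norm -/

/-- A C*-seminorm on a unital complex *-algebra. -/
structure CStarSeminorm (P : Type*) [Ring P] [StarRing P] [Algebra ℂ P] extends
    Seminorm ℂ P where
  mul_le' : ∀ x y, toFun (x * y) ≤ toFun x * toFun y
  star_mul_self' : ∀ x, toFun (star x * x) = toFun x ^ 2

namespace CStarSeminorm

variable {P : Type*} [Ring P] [StarRing P] [Algebra ℂ P]

theorem one_le (p : CStarSeminorm P) : p.toSeminorm 1 ≤ 1 := by
  have h : p.toSeminorm (star 1 * 1) = p.toSeminorm 1 ^ 2 := p.star_mul_self' 1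
  rw [star_one, one_mul] at h
  have h0 := apply_nonneg p.toSeminorm 1
  nlinarith

theorem mul_le (p : CStarSeminorm P) (x y : P) :
    p.toSeminorm (x * y) ≤ p.toSeminorm x * p.toSeminorm y := p.mul_le' x y

theorem star_mul_self (p : CStarSeminorm P) (x : P) :
    p.toSeminorm (star x * x) = p.toSeminorm x ^ 2 := p.star_mul_self' x

theorem le_star (p : CStarSeminorm P) (x : P) :
    p.toSeminorm x ≤ p.toSeminorm (star x) := by
  have h := p.star_mul_self x
  have h1 := p.mul_le (star x) x
  have h0 := apply_nonneg p.toSeminorm x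
  have h2 := apply_nonneg p.toSeminorm (star x)
  by_contra! hlt
  nlinarith

theorem star_eq (p : CStarSeminorm P) (x : P) :
    p.toSeminorm (star x) = p.toSeminorm x :=
  le_antisymm (by simpa using p.le_star (star x)) (p.le_star x)

instance : Inhabited (CStarSeminorm P) :=
  ⟨{ (0 : Seminorm ℂ P) with
      mul_le' := fun x y => by
        show (0 : Seminorm ℂ P) (x * y) ≤ (0 : Seminorm ℂ P) x * (0 : Seminorm ℂ P) y
        simp
      star_mul_self' := fun x => by
        show (0 : Seminorm ℂ P) (star x * x) = (0 : Seminorm ℂ P) x ^ 2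
        simp }⟩

/-- The largest C*-seminorm, i.e. the pointwise supremum of all C*-seminorms, on a *-algebra on
which these are pointwise bounded. -/
def sup (h : ∀ x : P, BddAbove (Set.range fun p : CStarSeminorm P => p.toSeminorm x)) :
    CStarSeminorm P where
  toFun x := ⨆ p : CStarSeminorm P, p.toSeminorm x
  map_zero' := by simp
  add_le' x y := ciSup_le fun p => (map_add_le_add p.toSeminorm x y).trans
    (add_le_add (le_ciSup (h x) p) (le_ciSup (h y) p))
  neg' x := by simp
  smul' c x := by
    simp_rw [map_smul_eq_mul]
    exact (Real.mul_iSup_of_nonneg (norm_nonneg c) _).symm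
  mul_le' x y := ciSup_le fun p => (p.mul_le x y).trans
    (mul_le_mul (le_ciSup (h x) p) (le_ciSup (h y) p) (apply_nonneg _ _)
      ((apply_nonneg p.toSeminorm x).trans (le_ciSup (h x) p)))
  star_mul_self' x := by
    apply le_antisymm
    · refine ciSup_le fun p => ?_
      rw [p.star_mul_self]
      exact pow_le_pow_left₀ (apply_nonneg _ _) (le_ciSup (h x) p) 2
    · have h0 : 0 ≤ ⨆ p : CStarSeminorm P, p.toSeminorm (star x * x) :=
        Real.iSup_nonneg fun p => apply_nonneg _ _
      have h1 : (⨆ p : CStarSeminorm P, p.toSeminorm x) ≤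
          Real.sqrt (⨆ p : CStarSeminorm P, p.toSeminorm (star x * x)) := by
        refine ciSup_le fun p => Real.le_sqrt_of_sq_le ?_
        rw [← p.star_mul_self]
        exact le_ciSup (h (star x * x)) p
      have h2 : 0 ≤ ⨆ p : CStarSeminorm P, p.toSeminorm x :=
        Real.iSup_nonneg fun p => apply_nonneg _ _
      calc _ ≤ Real.sqrt (⨆ p : CStarSeminorm P, p.toSeminorm (star x * x)) ^ 2 :=
            pow_le_pow_left₀ h2 h1 2
        _ = _ := Real.sq_sqrt h0

end CStarSeminorm

/-! ### The *-algebra generated by the field operators -/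

variable (H : Type*) [NormedAddCommGroup H] [InnerProductSpace ℂ H]

/-- The real quadratic form `ξ ↦ -‖ξ‖²` on a complex Hilbert space. -/
def carForm : QuadraticForm ℝ H :=
  letI : InnerProductSpace ℝ H := InnerProductSpace.rclikeToReal ℂ H;
  -(LinearMap.BilinMap.toQuadraticMap (innerₗ H))

theorem carForm_apply (ξ : H) : carForm H ξ = -‖ξ‖ ^ 2 := by
  simp [carForm]

/-- The *-algebra generated by the field operators `Φ(ξ)`, `ξ ∈ H`, i.e. the unital complex
*-algebra generated by selfadjoint elements `Φ(ξ)`, real linear in `ξ`, with `Φ(ξ)² = ‖ξ‖² 1`. It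
is realized as the complexification of a real Clifford algebra, with `Φ(ξ) = i ⊗ ξ`; the minus sign
in the quadratic form is there because the generators of a Clifford algebra in Mathlib are
skewadjoint. -/
def CARPoly : Type _ := ℂ ⊗[ℝ] CliffordAlgebra (carForm H)

namespace CARPoly

instance : Ring (CARPoly H) := inferInstanceAs (Ring (ℂ ⊗[ℝ] CliffordAlgebra (carForm H)))

instance : Algebra ℂ (CARPoly H) :=
  inferInstanceAs (Algebra ℂ (ℂ ⊗[ℝ] CliffordAlgebra (carForm H)))

instance cliffordStarModule : StarModule ℝ (CliffordAlgebra (carForm H)) :=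
  ⟨fun r x => by simp⟩

/-- The conjugate linear involution with `(z ⊗ x)* = z̄ ⊗ x*`. -/
instance : StarAddMonoid (CARPoly H) :=
  inferInstanceAs (StarAddMonoid (ℂ ⊗[ℝ] CliffordAlgebra (carForm H)))

variable {H}

/-- The elementary tensor `z ⊗ x`. -/
def tmul (z : ℂ) (x : CliffordAlgebra (carForm H)) : CARPoly H := z ⊗ₜ[ℝ] x

theorem star_tmul (z : ℂ) (x : CliffordAlgebra (carForm H)) :
    star (tmul z x) = tmul (star z) (star x) := rfl

theorem tmul_mul_tmul (z w : ℂ) (x y : CliffordAlgebra (carForm H)) :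
    tmul z x * tmul w y = tmul (z * w) (x * y) := Algebra.TensorProduct.tmul_mul_tmul _ _ _ _

theorem smul_tmul (c z : ℂ) (x : CliffordAlgebra (carForm H)) :
    c • tmul z x = tmul (c * z) x := TensorProduct.smul_tmul' c z x

theorem tmul_add (z : ℂ) (x y : CliffordAlgebra (carForm H)) :
    tmul z (x + y) = tmul z x + tmul z y := TensorProduct.tmul_add _ _ _

theorem tmul_real_smul (r : ℝ) (z : ℂ) (x : CliffordAlgebra (carForm H)) :
    tmul z (r • x) = tmul (r * z) x := by
  unfold tmul
  rw [TensorProduct.tmul_smul, TensorProduct.smul_tmul', Complex.real_smul]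

theorem one_def : (1 : CARPoly H) = tmul 1 1 := rfl

@[elab_as_elim]
theorem tmul_induction {motive : CARPoly H → Prop} (x : CARPoly H)
    (tmul : ∀ z x, motive (tmul z x)) (add : ∀ x y, motive x → motive y → motive (x + y)) :
    motive x := by
  refine TensorProduct.induction_on (motive := motive) x ?_ tmul add
  have h0 := tmul 0 0
  rwa [CARPoly.tmul, TensorProduct.zero_tmul] at h0

instance : StarRing (CARPoly H) where
  star_mul x y := by
    induction x using tmul_induction with
    | add x x' hx hx' => simp [add_mul, mul_add, hx, hx']
    | tmul z x =>
      induction y using tmul_induction with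
      | add y y' hy hy' => simp [add_mul, mul_add, hy, hy']
      | tmul w y => simp [tmul_mul_tmul, star_tmul, mul_comm]
  star_add := star_add

instance : StarModule ℂ (CARPoly H) where
  star_smul c x := by
    induction x using tmul_induction with
    | add x x' hx hx' => simp [hx, hx']
    | tmul z x => simp [smul_tmul, star_tmul]

/-- The field operator `Φ(ξ)`. -/
def field (ξ : H) : CARPoly H := tmul Complex.I (CliffordAlgebra.ι (carForm H) ξ)

theorem star_field (ξ : H) : star (field ξ) = field ξ := by
  rw [field, star_tmul, CliffordAlgebra.star_ι]
  exact (TensorProduct.tmul_neg (R := ℝ) _ _).trans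
    ((TensorProduct.neg_tmul (R := ℝ) _ _).symm.trans (by simp [tmul]))

theorem field_add (ξ η : H) : field (ξ + η) = field ξ + field η := by
  simp [field, tmul_add]

theorem field_real_smul (r : ℝ) (ξ : H) : field (r • ξ) = (r : ℂ) • field ξ := by
  rw [field, field, map_smul, tmul_real_smul, smul_tmul]

theorem field_mul_self (ξ : H) : field ξ * field ξ = ((‖ξ‖ : ℂ) ^ 2) • 1 := by
  rw [field, tmul_mul_tmul, CliffordAlgebra.ι_sq_scalar, carForm_apply,
    Algebra.algebraMap_eq_smul_one, tmul_real_smul, one_def, smul_tmul]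
  simp

/-- C*-seminorms are pointwise bounded on the algebra generated by the field operators. -/
theorem bddAbove (x : CARPoly H) :
    BddAbove (Set.range fun p : CStarSeminorm (CARPoly H) => p.toSeminorm x) := by
  suffices h : ∃ C, ∀ p : CStarSeminorm (CARPoly H), p.toSeminorm x ≤ C by
    obtain ⟨C, hC⟩ := h
    exact ⟨C, by rintro _ ⟨p, rfl⟩; exact hC p⟩
  induction x using tmul_induction with
  | add x y hx hy =>
    obtain ⟨C, hC⟩ := hx
    obtain ⟨D, hD⟩ := hy
    exact ⟨C + D, fun p => (map_add_le_add _ _ _).trans (add_le_add (hC p) (hD p))⟩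
  | tmul z x =>
    have hscal : ∀ (c : ℂ) (y : CARPoly H),
        (∃ C, ∀ p : CStarSeminorm (CARPoly H), p.toSeminorm y ≤ C) →
        ∃ C, ∀ p : CStarSeminorm (CARPoly H), p.toSeminorm (c • y) ≤ C := by
      rintro c y ⟨C, hC⟩
      refine ⟨‖c‖ * C, fun p => ?_⟩
      rw [map_smul_eq_mul]
      exact mul_le_mul_of_nonneg_left (hC p) (norm_nonneg c)
    have hz : tmul z x = z • tmul 1 x := by simp [smul_tmul]
    rw [hz]
    apply hscal
    induction x using CliffordAlgebra.induction with
    | algebraMap r =>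
      have : tmul 1 (algebraMap ℝ (CliffordAlgebra (carForm H)) r) = (r : ℂ) • 1 := by
        rw [Algebra.algebraMap_eq_smul_one, tmul_real_smul, one_def, smul_tmul]
      rw [this]
      exact hscal _ _ ⟨1, fun p => p.one_le⟩
    | ι ξ =>
      have : tmul 1 (CliffordAlgebra.ι (carForm H) ξ) = (-Complex.I) • field ξ := by
        rw [field, smul_tmul]; simp
      rw [this]
      refine hscal _ _ ⟨‖ξ‖, fun p => ?_⟩
      have h := p.star_mul_self (field ξ)
      rw [star_field, field_mul_self, map_smul_eq_mul] at h
      have h1 := p.one_le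
      have h0 := apply_nonneg p.toSeminorm (field ξ)
      refine le_of_sq_le_sq ?_ (norm_nonneg ξ)
      rw [← h]
      simp only [norm_pow, Complex.norm_real, norm_norm]
      nlinarith [sq_nonneg ‖ξ‖]
    | mul x y hx hy =>
      obtain ⟨C, hC⟩ := hx (by simp [smul_tmul])
      obtain ⟨D, hD⟩ := hy (by simp [smul_tmul])
      refine ⟨C * D, fun p => ?_⟩
      have : tmul 1 (x * y) = tmul 1 x * tmul 1 y := by simp [tmul_mul_tmul]
      rw [this]
      exact (p.mul_le _ _).trans (mul_le_mul (hC p) (hD p) (apply_nonneg _ _)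
        ((apply_nonneg _ _).trans (hC p)))
    | add x y hx hy =>
      obtain ⟨C, hC⟩ := hx (by simp [smul_tmul])
      obtain ⟨D, hD⟩ := hy (by simp [smul_tmul])
      refine ⟨C + D, fun p => ?_⟩
      rw [tmul_add]
      exact (map_add_le_add _ _ _).trans (add_le_add (hC p) (hD p))

variable (H) in
/-- The largest C*-seminorm. -/
def cstarSeminorm : CStarSeminorm (CARPoly H) := CStarSeminorm.sup bddAbove

theorem le_cstarSeminorm (p : CStarSeminorm (CARPoly H)) (x : CARPoly H) :
    p.toSeminorm x ≤ (cstarSeminorm H).toSeminorm x := le_ciSup (bddAbove x) p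

instance : SeminormedRing (CARPoly H) where
  toNorm := ⟨fun x => (cstarSeminorm H).toSeminorm x⟩
  toRing := inferInstance
  toPseudoMetricSpace :=
    (cstarSeminorm H).toSeminorm.toAddGroupSeminorm.toSeminormedAddGroup.toPseudoMetricSpace
  dist_eq := (cstarSeminorm H).toSeminorm.toAddGroupSeminorm.toSeminormedAddGroup.dist_eq
  norm_mul_le := (cstarSeminorm H).mul_le

theorem norm_def (x : CARPoly H) : ‖x‖ = (cstarSeminorm H).toSeminorm x := rfl

instance : NormedAlgebra ℂ (CARPoly H) where
  norm_smul_le c x := (map_smul_eq_mul (cstarSeminorm H).toSeminorm c x).le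

instance : NormedStarGroup (CARPoly H) where
  norm_star_le x := ((cstarSeminorm H).star_eq x).le

end CARPoly

/-! ### The CAR algebra -/

/-- The CAR algebra over `H`: the enveloping C*-algebra of the *-algebra generated by the field
operators, i.e. the universal C*-algebra on the canonical anticommutation relations. -/
def CAR : Type _ := UniformSpace.Completion (CARPoly H)

namespace CAR

open UniformSpace

instance : NormedRing (CAR H) := inferInstanceAs (NormedRing (Completion (CARPoly H)))

instance : CompleteSpace (CAR H) := inferInstanceAs (CompleteSpace (Completion (CARPoly H)))

instance : Algebra ℂ (CAR H) := inferInstanceAs (Algebra ℂ (Completion (CARPoly H)))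

instance : NormedAlgebra ℂ (CAR H) where
  norm_smul_le := norm_smul_le (α := ℂ) (β := Completion (CARPoly H))

variable {H}

/-- The canonical map from polynomials in the fields to the CAR algebra. -/
def ofPoly : CARPoly H →ₐ[ℂ] CAR H where
  __ := (Completion.coeRingHom : CARPoly H →+* Completion (CARPoly H))
  commutes' _ := rfl

theorem norm_ofPoly (x : CARPoly H) : ‖ofPoly x‖ = ‖x‖ := Completion.norm_coe x

theorem isometry_ofPoly : Isometry (ofPoly (H := H)) := Completion.coe_isometry

theorem denseRange_ofPoly : DenseRange (ofPoly (H := H)) := Completion.denseRange_coe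

@[elab_as_elim]
theorem induction_on {motive : CAR H → Prop} (x : CAR H) (closed : IsClosed {x | motive x})
    (ofPoly : ∀ x, motive (ofPoly x)) : motive x :=
  denseRange_ofPoly.induction_on (p := motive) x closed ofPoly

instance : Star (CAR H) := ⟨Completion.map (star : CARPoly H → CARPoly H)⟩

theorem ofPoly_star (x : CARPoly H) : ofPoly (star x) = star (ofPoly x) :=
  (Completion.map_coe (starₗᵢ ℂ : CARPoly H ≃ₗᵢ⋆[ℂ] CARPoly H).isometry.uniformContinuous x).symm

theorem continuous_star' : Continuous (star : CAR H → CAR H) := Completion.continuous_map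

instance : StarRing (CAR H) where
  star_involutive x := by
    induction x using induction_on with
    | closed => exact isClosed_eq (continuous_star'.comp continuous_star') continuous_id
    | ofPoly x => rw [← ofPoly_star, ← ofPoly_star, star_star]
  star_mul x y := by
    induction x using induction_on with
    | closed =>
      exact isClosed_eq (continuous_star'.comp (continuous_mul_const y))
        ((continuous_const_mul _).comp continuous_star')
    | ofPoly x =>
      induction y using induction_on with
      | closed =>
        exact isClosed_eq (continuous_star'.comp (continuous_const_mul _))
          ((continuous_mul_const _).comp continuous_star')
      | ofPoly y => simp_rw [← map_mul, ← ofPoly_star, ← map_mul, star_mul]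
  star_add x y := by
    induction x using induction_on with
    | closed =>
      exact isClosed_eq (continuous_star'.comp (continuous_add_const y))
        ((continuous_add_const _).comp continuous_star')
    | ofPoly x =>
      induction y using induction_on with
      | closed =>
        exact isClosed_eq (continuous_star'.comp (continuous_const_add _))
          ((continuous_const_add _).comp continuous_star')
      | ofPoly y => simp_rw [← map_add, ← ofPoly_star, ← map_add, star_add]

instance : CStarAlgebra (CAR H) where
  norm_mul_self_le x := by
    induction x using induction_on with
    | closed =>
      exact isClosed_le (continuous_norm.mul continuous_norm)
        (continuous_norm.comp (continuous_star'.mul continuous_id))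
    | ofPoly x =>
      rw [← ofPoly_star, ← map_mul, norm_ofPoly, norm_ofPoly, CARPoly.norm_def, CARPoly.norm_def,
        CStarSeminorm.star_mul_self, sq]
  star_smul c x := by
    induction x using induction_on with
    | closed =>
      exact isClosed_eq (continuous_star'.comp (continuous_const_smul c))
        ((continuous_const_smul _).comp continuous_star')
    | ofPoly x => simp_rw [← map_smul, ← ofPoly_star, ← map_smul, star_smul]

/-- The selfadjoint field operator `Φ(ξ) = a*(ξ) + a(ξ)`. -/
def field (ξ : H) : CAR H := ofPoly (CARPoly.field ξ)

/-- The annihilation operator `a(ξ) = (Φ(ξ) + i Φ(iξ)) / 2`; its adjoint `star (a ξ)` is the creation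
operator `a*(ξ)`. -/
def a (ξ : H) : CAR H := (1 / 2 : ℂ) • (field ξ + Complex.I • field (Complex.I • ξ))

theorem star_field (ξ : H) : star (field ξ) = field ξ := by
  rw [field, ← ofPoly_star, CARPoly.star_field]

theorem field_add (ξ η : H) : field (ξ + η) = field ξ + field η := by
  simp [field, CARPoly.field_add]

theorem field_real_smul (r : ℝ) (ξ : H) : field (r • ξ) = (r : ℂ) • field ξ := by
  rw [field, CARPoly.field_real_smul, map_smul, field]

theorem field_neg (ξ : H) : field (-ξ) = -field ξ := by
  simpa using field_real_smul (-1) ξ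

theorem field_mul_self (ξ : H) : field ξ * field ξ = ((‖ξ‖ : ℂ) ^ 2) • 1 := by
  rw [field, ← map_mul, CARPoly.field_mul_self, map_smul, map_one]

/-- The anticommutation relations of the field operators. -/
theorem field_mul_add_mul (ξ η : H) :
    field ξ * field η + field η * field ξ = ((2 * (inner ℂ ξ η).re : ℝ) : ℂ) • 1 := by
  have h := field_mul_self (ξ + η)
  rw [field_add, add_mul, mul_add, mul_add, field_mul_self, field_mul_self] at h
  have h2 : ((‖ξ + η‖ : ℂ) ^ 2) = (‖ξ‖ : ℂ) ^ 2 + ((2 * (inner ℂ ξ η).re : ℝ) : ℂ)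
      + (‖η‖ : ℂ) ^ 2 := by
    have := norm_add_sq (𝕜 := ℂ) ξ η
    rw [RCLike.re_eq_complex_re] at this
    exact_mod_cast this
  rw [h2, add_smul, add_smul] at h
  rw [← sub_eq_zero] at h ⊢
  exact Eq.trans (by abel) h

theorem star_a (ξ : H) :
    star (a ξ) = (1 / 2 : ℂ) • (field ξ - Complex.I • field (Complex.I • ξ)) := by
  simp [a, star_field, star_smul, sub_eq_add_neg]

theorem field_eq (ξ : H) : field ξ = star (a ξ) + a ξ := by
  rw [star_a, a]
  module

/-- `ξ ↦ a*(ξ)` is additive. -/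
theorem a_add (ξ η : H) : a (ξ + η) = a ξ + a η := by
  simp only [a, smul_add, field_add]
  abel

/-- `ξ ↦ a(ξ)` is conjugate homogeneous, i.e. `ξ ↦ a*(ξ)` is homogeneous. -/
theorem a_smul (c : ℂ) (ξ : H) : a (c • ξ) = star c • a ξ := by
  have h1 : c • ξ = c.re • ξ + c.im • (Complex.I • ξ) := by
    conv_lhs => rw [← Complex.re_add_im c]
    rw [add_smul, mul_smul]; rfl
  have h2 : Complex.I • (c • ξ) = c.re • (Complex.I • ξ) + -(c.im • ξ) := by
    rw [h1, smul_add, smul_comm, smul_comm Complex.I c.im, smul_smul]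
    simp
  have h3 : star c = c.re - c.im * Complex.I := by
    apply Complex.ext <;> simp
  rw [a, a, h2, h1, h3]
  simp only [field_add, field_neg, field_real_smul]
  have := Complex.I_mul_I
  match_scalars
  · ring
  · linear_combination ((c.im : ℂ) / 2) * this

theorem star_a_mul_a_add (φ ψ : H) :
    star (a φ) * a ψ + a ψ * star (a φ) = inner ℂ ψ φ • (1 : CAR H) := by
  have e : star (a φ) * a ψ + a ψ * star (a φ) = (1 / 4 : ℂ) •
      ((field φ * field ψ + field ψ * field φ)
      + Complex.I • (field φ * field (Complex.I • ψ) + field (Complex.I • ψ) * field φ)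
      - Complex.I • (field (Complex.I • φ) * field ψ + field ψ * field (Complex.I • φ))
      + (field (Complex.I • φ) * field (Complex.I • ψ)
        + field (Complex.I • ψ) * field (Complex.I • φ))) := by
    rw [star_a, a]
    simp only [add_mul, mul_add, sub_mul, mul_sub, smul_mul_assoc, mul_smul_comm]
    match_scalars <;> ring_nf <;> norm_num
  rw [e]
  simp only [field_mul_add_mul]
  rw [← inner_conj_symm ψ φ]
  simp only [inner_smul_left, inner_smul_right]
  generalize inner ℂ φ ψ = w
  match_scalars
  apply Complex.ext <;> simp <;> ring

theorem a_mul_a_add (φ ψ : H) : a φ * a ψ + a ψ * a φ = (0 : CAR H) := by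
  have e : a φ * a ψ + a ψ * a φ = (1 / 4 : ℂ) •
      ((field φ * field ψ + field ψ * field φ)
      + Complex.I • (field φ * field (Complex.I • ψ) + field (Complex.I • ψ) * field φ)
      + Complex.I • (field (Complex.I • φ) * field ψ + field ψ * field (Complex.I • φ))
      - (field (Complex.I • φ) * field (Complex.I • ψ)
        + field (Complex.I • ψ) * field (Complex.I • φ))) := by
    simp only [a, add_mul, mul_add, smul_mul_assoc, mul_smul_comm]
    match_scalars <;> ring_nf <;> norm_num
  rw [e]
  simp only [field_mul_add_mul, inner_smul_left, inner_smul_right]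
  match_scalars
  apply Complex.ext <;> simp

/-- The C*-algebra `CAR H` is generated by the `a(φ)`. -/
theorem dense_adjoin :
    Dense (StarAlgebra.adjoin ℂ (Set.range (a : H → CAR H)) : Set (CAR H)) := by
  refine denseRange_ofPoly.mono ?_
  rintro _ ⟨x, rfl⟩
  have ha : ∀ ξ : H, a ξ ∈ StarAlgebra.adjoin ℂ (Set.range (a : H → CAR H)) := fun ξ =>
    StarAlgebra.subset_adjoin ℂ _ ⟨ξ, rfl⟩
  induction x using CARPoly.tmul_induction with
  | add x y hx hy => rw [map_add]; exact add_mem hx hy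
  | tmul z x =>
    have hz : CARPoly.tmul z x = z • CARPoly.tmul 1 x := by simp [CARPoly.smul_tmul]
    rw [hz, map_smul]
    apply SMulMemClass.smul_mem
    clear hz
    induction x using CliffordAlgebra.induction with
    | algebraMap r =>
      rw [Algebra.algebraMap_eq_smul_one, CARPoly.tmul_real_smul, ← CARPoly.smul_tmul,
        ← CARPoly.one_def, map_smul, map_one]
      exact SMulMemClass.smul_mem _ (one_mem _)
    | ι ξ =>
      have : CARPoly.tmul 1 (CliffordAlgebra.ι (carForm H) ξ)
          = (-Complex.I) • CARPoly.field ξ := by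
        rw [CARPoly.field, CARPoly.smul_tmul]; simp
      rw [this, map_smul]
      refine SMulMemClass.smul_mem _ ?_
      change field ξ ∈ _
      rw [field_eq]
      exact add_mem (star_mem (ha ξ)) (ha ξ)
    | mul x y hx hy =>
      have : CARPoly.tmul 1 (x * y) = CARPoly.tmul 1 x * CARPoly.tmul 1 y := by
        simp [CARPoly.tmul_mul_tmul]
      rw [this, map_mul]
      exact mul_mem hx hy
    | add x y hx hy =>
      rw [CARPoly.tmul_add, map_add]
      exact add_mem hx hy

/-- A family `b(φ)` satisfying the canonical anticommutation relations: `b*(φ)` is linear in `φ`,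
`{b*(φ), b(ψ)} = ⟨ψ, φ⟩ 1` and `{b(φ), b(ψ)} = 0`. -/
structure IsCAR {B : Type*} [CStarAlgebra B] (b : H → B) : Prop where
  creation_add : ∀ φ ψ, star (b (φ + ψ)) = star (b φ) + star (b ψ)
  creation_smul : ∀ (c : ℂ) (φ), star (b (c • φ)) = c • star (b φ)
  anticomm_creation : ∀ φ ψ, star (b φ) * b ψ + b ψ * star (b φ) = inner ℂ ψ φ • (1 : B)
  anticomm : ∀ φ ψ, b φ * b ψ + b ψ * b φ = 0

theorem isCAR_a : IsCAR (a : H → CAR H) where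
  creation_add φ ψ := by rw [a_add, star_add]
  creation_smul c φ := by rw [a_smul, star_smul, star_star]
  anticomm_creation := star_a_mul_a_add
  anticomm := a_mul_a_add

section lift

variable {B : Type*} [CStarAlgebra B] {b : H → B} (hb : IsCAR b)

/-- The real linear map `ξ ↦ -i (b*(ξ) + b(ξ))`. -/
def liftField : H →ₗ[ℝ] B where
  toFun ξ := (-Complex.I) • (star (b ξ) + b ξ)
  map_add' ξ η := by
    have h := hb.creation_add ξ η
    have h' : b (ξ + η) = b ξ + b η := by
      rw [← star_inj, h, star_add]
    rw [h, h']
    module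
  map_smul' r ξ := by
    have h := hb.creation_smul r ξ
    have h' : b ((r : ℂ) • ξ) = (r : ℂ) • b ξ := by
      rw [← star_inj, h, star_smul]; simp
    rw [Complex.coe_smul] at h h'
    rw [h, h', Complex.coe_smul, Complex.coe_smul, RingHom.id_apply, ← smul_add, smul_comm]

theorem liftField_apply (ξ : H) : liftField hb ξ = (-Complex.I) • (star (b ξ) + b ξ) := rfl

theorem liftField_mul_self (ξ : H) :
    liftField hb ξ * liftField hb ξ = algebraMap ℝ B (carForm H ξ) := by
  have h1 : b ξ * b ξ = 0 := by
    have h := hb.anticomm ξ ξ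
    rw [← two_smul ℂ] at h
    exact (smul_eq_zero.mp h).resolve_left two_ne_zero
  have h2 : star (b ξ) * star (b ξ) = 0 := by rw [← star_mul, h1, star_zero]
  have h3 := hb.anticomm_creation ξ ξ
  rw [inner_self_eq_norm_sq_to_K] at h3
  have h4 : (star (b ξ) + b ξ) * (star (b ξ) + b ξ) = ((‖ξ‖ : ℂ) ^ 2) • (1 : B) := by
    rw [add_mul, mul_add, mul_add, h1, h2, zero_add, add_zero]
    exact h3
  rw [liftField_apply, smul_mul_smul_comm, h4, carForm_apply, Algebra.algebraMap_eq_smul_one,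
    smul_smul, ← Complex.coe_smul]
  congr 1
  simp

/-- The homomorphism on polynomials in the fields given by a representation of the relations. -/
def liftPoly : CARPoly H →ₐ[ℂ] B :=
  Algebra.TensorProduct.lift (Algebra.ofId ℂ B)
    (CliffordAlgebra.lift (carForm H) ⟨liftField hb, liftField_mul_self hb⟩)
    (fun _ _ => Algebra.commutes _ _)

theorem liftPoly_tmul (z : ℂ) (x : CliffordAlgebra (carForm H)) :
    liftPoly hb (CARPoly.tmul z x) = z •
      CliffordAlgebra.lift (carForm H) ⟨liftField hb, liftField_mul_self hb⟩ x := by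
  rw [Algebra.smul_def]
  exact Algebra.TensorProduct.lift_tmul _ _ _ _ _

theorem liftPoly_field (ξ : H) : liftPoly hb (CARPoly.field ξ) = star (b ξ) + b ξ := by
  rw [CARPoly.field, liftPoly_tmul, CliffordAlgebra.lift_ι_apply, liftField_apply, smul_smul]
  simp

theorem liftPoly_star (x : CARPoly H) : liftPoly hb (star x) = star (liftPoly hb x) := by
  induction x using CARPoly.tmul_induction with
  | add x y hx hy => simp only [star_add, map_add, hx, hy]
  | tmul z x =>
    rw [CARPoly.star_tmul, liftPoly_tmul, liftPoly_tmul, star_smul]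
    congr 1
    induction x using CliffordAlgebra.induction with
    | algebraMap r =>
      rw [CliffordAlgebra.star_algebraMap, AlgHom.commutes, Algebra.algebraMap_eq_smul_one,
        star_smul]
      simp
    | ι ξ =>
      rw [CliffordAlgebra.star_ι, map_neg, CliffordAlgebra.lift_ι_apply, liftField_apply,
        star_smul, star_add, star_star]
      simp [add_comm]
    | mul x y hx hy => rw [star_mul, map_mul, map_mul, star_mul, hx, hy]
    | add x y hx hy => rw [star_add, map_add, map_add, star_add, hx, hy]

theorem norm_liftPoly_le (x : CARPoly H) : ‖liftPoly hb x‖ ≤ ‖x‖ := by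
  let p : CStarSeminorm (CARPoly H) :=
    { toFun := fun x => ‖liftPoly hb x‖
      map_zero' := by simp
      add_le' := fun x y => by rw [map_add]; exact norm_add_le _ _
      neg' := fun x => by simp
      smul' := fun c x => by rw [map_smul, norm_smul]
      mul_le' := fun x y => by
        rw [map_mul]; exact norm_mul_le _ _
      star_mul_self' := fun x => by
        change ‖liftPoly hb (star x * x)‖ = ‖liftPoly hb x‖ ^ 2
        rw [map_mul, liftPoly_star, CStarRing.norm_star_mul_self, sq] }
  exact CARPoly.le_cstarSeminorm p x

theorem continuous_liftPoly : Continuous (liftPoly hb) :=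
  AddMonoidHomClass.continuous_of_bound (liftPoly hb) 1 fun x => by
    simpa using norm_liftPoly_le hb x

/-- The universal property of the CAR algebra. -/
def lift : CAR H →⋆ₐ[ℂ] B where
  __ := (Completion.extensionHom (liftPoly hb).toRingHom (continuous_liftPoly hb) :
    Completion (CARPoly H) →+* B)
  commutes' c := (Completion.extensionHom_coe (liftPoly hb).toRingHom (continuous_liftPoly hb)
    (algebraMap ℂ (CARPoly H) c)).trans ((liftPoly hb).commutes c)
  map_star' x := by
    have hcont : @Continuous (CAR H) B _ _ (Completion.extensionHom (liftPoly hb).toRingHom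
        (continuous_liftPoly hb)) := Completion.continuous_extension
    have hcoe : ∀ y : CARPoly H, Completion.extensionHom (liftPoly hb).toRingHom
        (continuous_liftPoly hb) (ofPoly y : CAR H) = liftPoly hb y :=
      Completion.extensionHom_coe (liftPoly hb).toRingHom (continuous_liftPoly hb)
    change Completion.extensionHom (liftPoly hb).toRingHom (continuous_liftPoly hb)
      (star x : CAR H)
      = star (Completion.extensionHom (liftPoly hb).toRingHom (continuous_liftPoly hb) x)
    induction x using CAR.induction_on with
    | closed =>
      exact isClosed_eq (hcont.comp continuous_star')
        (continuous_star.comp hcont)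
    | ofPoly y => rw [← ofPoly_star, hcoe, hcoe, liftPoly_star]

theorem lift_ofPoly (x : CARPoly H) : lift hb (ofPoly x) = liftPoly hb x :=
  Completion.extensionHom_coe (liftPoly hb).toRingHom (continuous_liftPoly hb) x

theorem lift_a (ξ : H) : lift hb (a ξ) = b ξ := by
  have h := hb.creation_smul Complex.I ξ
  have h' : b (Complex.I • ξ) = (-Complex.I) • b ξ := by
    rw [← star_inj, h, star_smul]; simp
  rw [a, map_smul, map_add, map_smul, field, field, lift_ofPoly, lift_ofPoly, liftPoly_field,
    liftPoly_field, h, h']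
  match_scalars <;> ring_nf <;> norm_num

/-- A *-homomorphism on the CAR algebra is determined by its values on the `a(φ)`. -/
theorem hom_ext {f g : CAR H →⋆ₐ[ℂ] B} (h : ∀ ξ, f (a ξ) = g (a ξ)) : f = g := by
  have hle : StarAlgebra.adjoin ℂ (Set.range (a : H → CAR H)) ≤ StarAlgHom.equalizer f g :=
    StarAlgebra.adjoin_le (by rintro _ ⟨ξ, rfl⟩; exact h ξ)
  ext x
  have hc : ∀ k : CAR H →⋆ₐ[ℂ] B, Continuous k := fun k =>
    AddMonoidHomClass.continuous_of_bound k 1 fun y => by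
      simpa using NonUnitalStarAlgHom.norm_apply_le k y
  exact congrFun (Continuous.ext_on dense_adjoin (hc f) (hc g) fun y hy => hle hy) x

end lift

theorem isCAR_comp (U : H ≃ₗᵢ[ℂ] H) : IsCAR fun φ => (a (U φ) : CAR H) where
  creation_add φ ψ := by rw [map_add, isCAR_a.creation_add]
  creation_smul c φ := by rw [map_smul, isCAR_a.creation_smul]
  anticomm_creation φ ψ := by rw [star_a_mul_a_add, LinearIsometryEquiv.inner_map_map]
  anticomm φ ψ := a_mul_a_add _ _

/-- The Bogoliubov automorphism of a unitary `U`, determined by `a(φ) ↦ a(Uφ)`. -/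
def bogoliubov (U : H ≃ₗᵢ[ℂ] H) : CAR H ≃⋆ₐ[ℂ] CAR H :=
  StarAlgEquiv.ofStarAlgHom (lift (isCAR_comp U)) (lift (isCAR_comp U.symm))
    (hom_ext fun ξ => by simp [lift_a]) (hom_ext fun ξ => by simp [lift_a])

theorem bogoliubov_a (U : H ≃ₗᵢ[ℂ] H) (ξ : H) : bogoliubov U (a ξ) = a (U ξ) :=
  lift_a (isCAR_comp U) ξ

/-- The grading automorphism `γ_G` of the CAR algebra, determined by `γ_G(a(φ)) = a(Gφ)`. -/
def grading [CompleteSpace H] (G : unitary (H →L[ℂ] H)) : CAR H ≃⋆ₐ[ℂ] CAR H :=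
  bogoliubov (Unitary.linearIsometryEquiv G)

theorem grading_a [CompleteSpace H] (G : unitary (H →L[ℂ] H)) (ξ : H) :
    grading G (a ξ) = a ((G : H →L[ℂ] H) ξ) :=
  bogoliubov_a _ ξ

theorem grading_grading [CompleteSpace H] (G : unitary (H →L[ℂ] H))
    (hG : IsSelfAdjoint (G : H →L[ℂ] H)) (x : CAR H) : grading G (grading G x) = x := by
  have hGG : ∀ ξ : H, (G : H →L[ℂ] H) ((G : H →L[ℂ] H) ξ) = ξ := fun ξ => by
    have h := (Unitary.mem_iff.mp G.2).1
    rw [hG.star_eq] at h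
    exact DFunLike.congr_fun h ξ
  have h : ((grading G : CAR H →⋆ₐ[ℂ] CAR H).comp (grading G : CAR H →⋆ₐ[ℂ] CAR H))
      = StarAlgHom.id ℂ (CAR H) :=
    hom_ext fun ξ => by simp [grading_a, hGG]
  exact DFunLike.congr_fun h x

end CAR

/-! ### Crossed products with `ℤ/2` -/

section CrossedProduct

variable {A : Type*} [CStarAlgebra A] (γ : A ≃⋆ₐ[ℂ] A) (hγ : ∀ x, γ (γ x) = x)

/-- The crossed product `A ⋊_γ ℤ/2` of a C*-algebra `A` by an involutive automorphism `γ`. Its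
underlying space is `A ⊕ A`, a pair `(a, b)` being represented by the matrix
`(a, b; γ(b), γ(a))` over `A`, from which it takes its product, involution and norm. -/
def CrossedProduct : StarSubalgebra ℂ (CStarMatrix (Fin 2) (Fin 2) A) where
  carrier := {M | M 1 0 = γ (M 0 1) ∧ M 1 1 = γ (M 0 0)}
  mul_mem' := by
    rintro M N ⟨h1, h2⟩ ⟨h3, h4⟩
    simp [CStarMatrix.mul_apply, h1, h2, h3, h4, hγ, add_comm]
  add_mem' := by
    rintro M N ⟨h1, h2⟩ ⟨h3, h4⟩
    simp [h1, h2, h3, h4]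
  algebraMap_mem' c := by
    have h : γ (algebraMap ℂ A c) = algebraMap ℂ A c := AlgHomClass.commutes γ c
    simp [CStarMatrix.algebraMap_apply, h]
  star_mem' := by
    rintro M ⟨h1, h2⟩
    simp [CStarMatrix.star_apply, h1, h2, hγ, map_star]

namespace CrossedProduct

instance : CStarAlgebra (CrossedProduct γ hγ) := by
  letI := CStarAlgebra.spectralOrder A
  haveI := CStarAlgebra.spectralOrderedRing A
  haveI : IsClosed ((CrossedProduct γ hγ : StarSubalgebra ℂ (CStarMatrix (Fin 2) (Fin 2) A)) :
      Set (CStarMatrix (Fin 2) (Fin 2) A)) := by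
    have hc : Continuous γ := map_continuous γ
    have he : ∀ i j, Continuous fun M : CStarMatrix (Fin 2) (Fin 2) A => M i j := fun i j =>
      (continuous_apply j).comp (continuous_apply i)
    exact (isClosed_eq (he 1 0) (hc.comp (he 0 1))).inter
      (isClosed_eq (he 1 1) (hc.comp (he 0 0)))
  exact StarSubalgebra.cstarAlgebra (CrossedProduct γ hγ)

/-- The element `(a, b)` of the crossed product. -/
def mk (a b : A) : CrossedProduct γ hγ :=
  ⟨CStarMatrix.ofMatrix !![a, b; γ b, γ a], by exact ⟨rfl, rfl⟩⟩

/-- The canonical conditional expectation `E(a, b) = a`. -/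
def E : CrossedProduct γ hγ →ₗ[ℂ] A where
  toFun x := (x : CStarMatrix (Fin 2) (Fin 2) A) 0 0
  map_add' _ _ := rfl
  map_smul' _ _ := rfl

theorem E_mk (a b : A) : E γ hγ (mk γ hγ a b) = a := rfl

theorem exists_eq_mk (x : CrossedProduct γ hγ) : ∃ a b, x = mk γ hγ a b := by
  obtain ⟨M, h1, h2⟩ := x
  refine ⟨M 0 0, M 0 1, Subtype.ext (CStarMatrix.ext fun i j => ?_)⟩
  fin_cases i <;> fin_cases j <;> simp [mk, h1, h2]

theorem mk_mul_mk (a b a' b' : A) : mk γ hγ a b * mk γ hγ a' b'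
    = mk γ hγ (a * a' + b * γ b') (a * b' + b * γ a') := by
  refine Subtype.ext (CStarMatrix.ext fun i j => ?_)
  change ((mk γ hγ a b : CStarMatrix (Fin 2) (Fin 2) A) *
    (mk γ hγ a' b' : CStarMatrix (Fin 2) (Fin 2) A)) i j = _
  fin_cases i <;> fin_cases j <;> simp [mk, CStarMatrix.mul_apply, hγ, add_comm]

theorem star_mk (a b : A) : star (mk γ hγ a b) = mk γ hγ (star a) (γ (star b)) := by
  refine Subtype.ext (CStarMatrix.ext fun i j => ?_)
  change star (mk γ hγ a b : CStarMatrix (Fin 2) (Fin 2) A) i j = _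
  fin_cases i <;> fin_cases j <;> simp [mk, CStarMatrix.star_apply, hγ, map_star]

theorem one_eq_mk : (1 : CrossedProduct γ hγ) = mk γ hγ 1 0 := by
  refine Subtype.ext (CStarMatrix.ext fun i j => ?_)
  change (1 : CStarMatrix (Fin 2) (Fin 2) A) i j = _
  fin_cases i <;> fin_cases j <;> simp [mk]

end CrossedProduct

end CrossedProduct

/-! ### Tracial states and twisted tracial functionals -/

section Functionals

variable {A : Type*} [CStarAlgebra A]

/-- A tracial state: a normalized positive linear functional with `ω(xy) = ω(yx)`. -/
structure IsTracialState (ω : A →ₗ[ℂ] ℂ) : Prop where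
  map_one : ω 1 = 1
  nonneg : ∀ x, 0 ≤ ω (star x * x)
  map_mul_comm : ∀ x y, ω (x * y) = ω (y * x)

/-- A `γ`-twisted tracial functional: `τ(xy) = τ(y γ(x))`. -/
def IsTwistedTracial (γ : A ≃⋆ₐ[ℂ] A) (τ : A →ₗ[ℂ] ℂ) : Prop :=
  ∀ x y, τ (x * y) = τ (y * γ x)

/-- A functional `τ` is dominated by a state `ω` if `|τ(x*y)|² ≤ ω(x*x) ω(y*y)`. -/
def IsDominatedBy (τ ω : A →ₗ[ℂ] ℂ) : Prop :=
  ∀ x y, ‖τ (star x * y)‖ ^ 2 ≤ (ω (star x * x)).re * (ω (star y * y)).re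

/-- A functional on the crossed product extends `ω` if `(a, 0) ↦ ω(a)`. -/
def IsExtension (γ : A ≃⋆ₐ[ℂ] A) (hγ : ∀ x, γ (γ x) = x) (ω : A →ₗ[ℂ] ℂ)
    (ω' : CrossedProduct γ hγ →ₗ[ℂ] ℂ) : Prop :=
  ∀ a, ω' (CrossedProduct.mk γ hγ a 0) = ω a

end Functionals

end

/-!
Write `Φ(ξ) = a(ξ)* + a(ξ)` for the selfadjoint field operators, so that products of them span a
dense subspace of the CAR algebra and `Φ(ξ)Φ(η) + Φ(η)Φ(ξ) = 2 Re⟨ξ, η⟩`.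

*Existence of a tracial state.* Polynomials in the fields form a complexified Clifford algebra, on
which the scalar part with respect to the identification with the exterior algebra is a trace
(`CARPoly.trace_mul_comm`). It is positive because the algebra generated by finitely many fields is
an orthogonal sum `P + Φ(ξ)P`, with `P` generated by one field less and `ξ` orthogonal to the
vectors generating `P` (`CARPoly.trace_star_mul_self_nonneg`). Its GNS representation is by bounded
operators, whence the trace is bounded for the largest C*-seminorm and extends to the completion
(`CAR.exists_isTracialState`).

*Uniqueness.* On a product of an odd number of fields a trace vanishes, since the product
anticommutes with the unitary `Φ(u)` for a unit vector `u` orthogonal to all vectors involved. On an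
even product, moving the first factor cyclically expresses the trace through shorter products
(`CAR.map_fieldProd_eq_zero`).

*Twisted traces.* Let `τ` be `γ_G`-twisted tracial. An even product of fields commutes with `Φ(u)`
for an odd unit vector `u` orthogonal to the vectors involved, which exists as the odd space is
infinite dimensional; since `γ_G(Φ(u)) = -Φ(u)`, the twisted trace property makes `τ` vanish there.
For odd products, `τ` is `γ_G`-invariant, while `-γ_G` is implemented on the finitely many fields
involved by a `γ_G`-invariant unit, the product of `Φ(e)Φ(ie)` over an orthonormal basis of the span
of their even parts (`CAR.exists_unit_implementing`); so `τ(X) = -τ(X)`. Domination by the tracial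
state makes `τ` continuous, hence zero.

*Crossed product.* If `ω` is a tracial state on the crossed product extending `μ₀`, then
`b ↦ ω(0, b)` is twisted tracial, and dominated by `μ₀` by the Cauchy–Schwarz inequality, so it
vanishes.
-/

noncomputable section

open scoped TensorProduct ComplexOrder

/-! ### The trace of a Clifford algebra -/

namespace CliffordAlgebra

variable {R M : Type*} [CommRing R] [AddCommGroup M] [Module R M] {Q : QuadraticForm R M}

theorem contractLeft_involute (d : Module.Dual R M) (x : CliffordAlgebra Q) :
    contractLeft d (involute x) = -involute (contractLeft d x) := by
  induction x using CliffordAlgebra.left_induction with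
  | algebraMap r => simp [contractLeft_algebraMap]
  | add x y hx hy => simp only [map_add, hx, hy, neg_add]
  | ι_mul x m hx =>
    simp only [map_mul, involute_ι, neg_mul, map_neg, contractLeft_ι_mul, hx, map_sub, map_smul]
    simp

/-- The graded commutator with a vector is the contraction with its polar form. -/
theorem ι_mul_sub_involute_mul_ι (m : M) (x : CliffordAlgebra Q) :
    ι Q m * x - involute x * ι Q m = contractLeft (Q.polarBilin m) x := by
  induction x using CliffordAlgebra.left_induction with
  | algebraMap r => simp [contractLeft_algebraMap, Algebra.commutes]
  | add x y hx hy => rw [map_add, map_add, mul_add, add_mul, ← hx, ← hy]; abel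
  | ι_mul x n hx =>
    rw [contractLeft_ι_mul, ← hx, map_mul, involute_ι, QuadraticMap.polarBilin_apply_apply,
      Algebra.smul_def, ← ι_mul_ι_add_swap]
    noncomm_ring

theorem changeForm_involute {Q' : QuadraticForm R M} {B : LinearMap.BilinForm R M}
    (h : B.toQuadraticMap = Q' - Q) (x : CliffordAlgebra Q) :
    changeForm h (involute x) = involute (changeForm h x) := by
  induction x using CliffordAlgebra.left_induction with
  | algebraMap r => simp
  | add x y hx hy => simp only [map_add, hx, hy]
  | ι_mul x m hx =>
    simp only [map_mul, involute_ι, neg_mul, map_neg, changeForm_ι_mul, hx, map_sub,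
      contractLeft_involute]
    abel

theorem algebraMapInv_involute (x : ExteriorAlgebra R M) :
    ExteriorAlgebra.algebraMapInv (involute x) = ExteriorAlgebra.algebraMapInv x := by
  have h : (ExteriorAlgebra.algebraMapInv (R := R) (M := M)).comp involute
      = ExteriorAlgebra.algebraMapInv := by
    ext m
    simp [ExteriorAlgebra.algebraMapInv]
  exact DFunLike.congr_fun h x

variable {B : LinearMap.BilinForm R M} (h : B.toQuadraticMap = 0 - Q)

/-- The normalized trace of a Clifford algebra: the scalar component with respect to the
identification with the exterior algebra given by a bilinear form `B` with `B(m, m) = -Q(m)`. -/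
def scalarPart : CliffordAlgebra Q →ₗ[R] R :=
  (ExteriorAlgebra.algebraMapInv (R := R) (M := M)).toLinearMap ∘ₗ changeForm h

theorem scalarPart_one : scalarPart h 1 = 1 := by
  simp [scalarPart]

theorem scalarPart_involute (x : CliffordAlgebra Q) :
    scalarPart h (involute x) = scalarPart h x := by
  simp only [scalarPart, LinearMap.comp_apply, changeForm_involute]
  exact algebraMapInv_involute _

theorem scalarPart_ι_mul (m : M) (x : CliffordAlgebra Q) :
    scalarPart h (ι Q m * x) = -scalarPart h (contractLeft (B m) x) := by
  have h0 : ExteriorAlgebra.algebraMapInv (R := R) (ι 0 m) = 0 := by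
    simp [ExteriorAlgebra.algebraMapInv]
  simp only [scalarPart, LinearMap.comp_apply, changeForm_ι_mul, changeForm_contractLeft,
    AlgHom.toLinearMap_apply, map_sub, map_mul, h0]
  simp

/-- The trace changes sign under graded cyclic permutation of a vector. -/
theorem scalarPart_involute_mul_ι (hB : ∀ m n, B m n = B n m) (m : M) (x : CliffordAlgebra Q) :
    scalarPart h (involute x * ι Q m) = -scalarPart h (ι Q m * x) := by
  have hp : Q.polarBilin m = -(2 : R) • B m := by
    ext n
    have hQ : Q = -B.toQuadraticMap := by rw [h, zero_sub, neg_neg]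
    rw [QuadraticMap.polarBilin_apply_apply, hQ, FunLike.coe_neg,
      QuadraticMap.polar_neg]
    simp [LinearMap.BilinMap.polar_toQuadraticMap, hB n m, two_mul]
  -- `tr(mx) - tr(θ(x)m)` is the trace of the contraction of `x` with `-2B(m)`, that is, `2 tr(mx)`
  have h1 := congrArg (scalarPart h) (ι_mul_sub_involute_mul_ι m x)
  rw [hp, map_smul, LinearMap.smul_apply, map_smul, map_sub] at h1
  have h2 := scalarPart_ι_mul h m x
  rw [smul_eq_mul] at h1
  linear_combination 2 * h2 - h1

end CliffordAlgebra

/-! ### The trace of the algebra generated by the field operators -/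

namespace CARPoly

variable {H : Type*} [NormedAddCommGroup H] [InnerProductSpace ℂ H]

/-- The parity automorphism, determined by `Φ(ξ) ↦ -Φ(ξ)`. -/
def parity : CARPoly H →ₐ[ℂ] CARPoly H :=
  Algebra.TensorProduct.map (AlgHom.id ℂ ℂ) CliffordAlgebra.involute

theorem parity_tmul (z : ℂ) (x : CliffordAlgebra (carForm H)) :
    parity (tmul z x) = tmul z (CliffordAlgebra.involute x) := rfl

theorem parity_field (ξ : H) : parity (field ξ) = -field ξ := by
  rw [field, parity_tmul, CliffordAlgebra.involute_ι]
  exact TensorProduct.tmul_neg (R := ℝ) _ _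

theorem field_mul_add_mul (ξ η : H) :
    field ξ * field η + field η * field ξ = ((2 * (inner ℂ ξ η).re : ℝ) : ℂ) • 1 := by
  have h := field_mul_self (ξ + η)
  rw [field_add, add_mul, mul_add, mul_add, field_mul_self, field_mul_self] at h
  have h2 : ((‖ξ + η‖ : ℂ) ^ 2) = (‖ξ‖ : ℂ) ^ 2 + ((2 * (inner ℂ ξ η).re : ℝ) : ℂ)
      + (‖η‖ : ℂ) ^ 2 := by
    have := norm_add_sq (𝕜 := ℂ) ξ η
    rw [RCLike.re_eq_complex_re] at this
    exact_mod_cast this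
  rw [h2, add_smul, add_smul] at h
  rw [← sub_eq_zero] at h ⊢
  exact Eq.trans (by abel) h

variable (H) in
theorem exists_bilinForm_eq_neg_carForm : ∃ B : LinearMap.BilinForm ℝ H,
    B.toQuadraticMap = 0 - carForm H ∧ ∀ ξ η, B ξ η = B η ξ := by
  let _ : InnerProductSpace ℝ H := InnerProductSpace.rclikeToReal ℂ H
  exact ⟨innerₗ H, by simp [carForm], fun ξ η => real_inner_comm η ξ⟩

variable (H) in
/-- The normalized trace on polynomials in the fields. -/
def trace : CARPoly H →ₗ[ℂ] ℂ :=
  TensorProduct.AlgebraTensorModule.lift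
    ((LinearMap.toSpanSingleton ℂ (CliffordAlgebra (carForm H) →ₗ[ℝ] ℂ)
      (Complex.ofRealAm.toLinearMap ∘ₗ CliffordAlgebra.scalarPart
        (exists_bilinForm_eq_neg_carForm H).choose_spec.1)))

theorem trace_tmul (z : ℂ) (x : CliffordAlgebra (carForm H)) :
    trace H (tmul z x) = z * CliffordAlgebra.scalarPart
      (exists_bilinForm_eq_neg_carForm H).choose_spec.1 x :=
  TensorProduct.AlgebraTensorModule.lift_tmul _ _ _

theorem trace_one : trace H 1 = 1 := by
  rw [one_def, trace_tmul, CliffordAlgebra.scalarPart_one]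
  simp

theorem trace_parity (x : CARPoly H) : trace H (parity x) = trace H x := by
  induction x using tmul_induction with
  | add x y hx hy => rw [map_add, map_add, map_add, hx, hy]
  | tmul z x => rw [parity_tmul, trace_tmul, trace_tmul, CliffordAlgebra.scalarPart_involute]

/-- The graded cyclicity of the trace, from which its cyclicity and the orthogonality of distinct
monomials both follow. -/
theorem trace_parity_mul_field (x : CARPoly H) (ξ : H) :
    trace H (parity x * field ξ) = -trace H (field ξ * x) := by
  induction x using tmul_induction with
  | add x y hx hy => rw [map_add, add_mul, mul_add, map_add, map_add, hx, hy, neg_add]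
  | tmul z x =>
    rw [field, parity_tmul, tmul_mul_tmul, tmul_mul_tmul, trace_tmul, trace_tmul,
      CliffordAlgebra.scalarPart_involute_mul_ι _
        (exists_bilinForm_eq_neg_carForm H).choose_spec.2]
    push_cast
    ring

theorem trace_mul_field (x : CARPoly H) (ξ : H) :
    trace H (x * field ξ) = trace H (field ξ * x) := by
  rw [← trace_parity, map_mul, parity_field, mul_neg, map_neg, trace_parity_mul_field, neg_neg]

theorem mem_adjoin_range_field (x : CARPoly H) :
    x ∈ Algebra.adjoin ℂ (Set.range (field : H → CARPoly H)) := by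
  induction x using tmul_induction with
  | add x y hx hy => exact add_mem hx hy
  | tmul z x =>
    have hz : tmul z x = z • tmul 1 x := by simp [smul_tmul]
    rw [hz]
    refine Subalgebra.smul_mem _ ?_ z
    clear hz
    induction x using CliffordAlgebra.induction with
    | algebraMap r =>
      rw [Algebra.algebraMap_eq_smul_one, tmul_real_smul, ← smul_tmul, ← one_def]
      exact Subalgebra.smul_mem _ (one_mem _) _
    | ι ξ =>
      have h : tmul 1 (CliffordAlgebra.ι (carForm H) ξ) = (-Complex.I) • field ξ := by
        rw [field, smul_tmul]; simp
      rw [h]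
      exact Subalgebra.smul_mem _ (Algebra.subset_adjoin (Set.mem_range_self ξ)) _
    | mul x y hx hy =>
      have h : tmul 1 (x * y) = tmul 1 x * tmul 1 y := by simp [tmul_mul_tmul]
      rw [h]
      exact mul_mem hx hy
    | add x y hx hy => rw [tmul_add]; exact add_mem hx hy

theorem trace_mul_comm (x y : CARPoly H) : trace H (x * y) = trace H (y * x) := by
  have hx := mem_adjoin_range_field x
  induction hx using Algebra.adjoin_induction generalizing y with
  | mem x hx => obtain ⟨ξ, rfl⟩ := hx; exact (trace_mul_field y ξ).symm
  | algebraMap r => rw [Algebra.commutes]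
  | add x x' _ _ hx hx' => rw [add_mul, mul_add, map_add, map_add, hx, hx']
  | mul x x' _ _ hx hx' => rw [mul_assoc, hx, mul_assoc, hx', mul_assoc]

theorem field_mul_eq_neg {ξ η : H} (h : (inner ℂ ξ η).re = 0) :
    field ξ * field η = -(field η * field ξ) := by
  rw [eq_neg_iff_add_eq_zero, field_mul_add_mul, h]
  simp

theorem field_mul_eq_parity_mul {S : Set H} {ξ : H} (hξ : ∀ η ∈ S, (inner ℂ ξ η).re = 0)
    {x : CARPoly H} (hx : x ∈ Algebra.adjoin ℂ (field '' S)) :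
    field ξ * x = parity x * field ξ := by
  induction hx using Algebra.adjoin_induction with
  | mem x hx =>
    obtain ⟨η, hη, rfl⟩ := hx
    rw [parity_field, field_mul_eq_neg (hξ η hη), neg_mul]
  | algebraMap r => rw [AlgHom.commutes, Algebra.commutes]
  | add x y _ _ hx hy => rw [map_add, mul_add, add_mul, hx, hy]
  | mul x y _ _ hx hy => rw [map_mul, ← mul_assoc, hx, mul_assoc, hy, mul_assoc]

/-- If `ξ` is orthogonal to `S`, the algebra generated by the `Φ(η)`, `η ∈ S`, and its multiple by
`Φ(ξ)` are orthogonal for the trace: `Φ(ξ)x = θ(x)Φ(ξ)` with the parity `θ`, and the trace changes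
sign under this exchange. -/
theorem trace_field_mul_eq_zero {S : Set H} {ξ : H} (hξ : ∀ η ∈ S, (inner ℂ ξ η).re = 0)
    {x : CARPoly H} (hx : x ∈ Algebra.adjoin ℂ (field '' S)) : trace H (field ξ * x) = 0 := by
  have h := trace_parity_mul_field x ξ
  rw [← field_mul_eq_parity_mul hξ hx] at h
  exact self_eq_neg.mp h

theorem star_mem_adjoin {S : Set H} {x : CARPoly H} (hx : x ∈ Algebra.adjoin ℂ (field '' S)) :
    star x ∈ Algebra.adjoin ℂ (field '' S) := by
  induction hx using Algebra.adjoin_induction with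
  | mem x hx =>
    obtain ⟨η, hη, rfl⟩ := hx
    rw [star_field]
    exact Algebra.subset_adjoin ⟨η, hη, rfl⟩
  | algebraMap r => rw [← algebraMap_star_comm]; exact Subalgebra.algebraMap_mem _ _
  | add x y _ _ hx hy => rw [star_add]; exact add_mem hx hy
  | mul x y _ _ hx hy => rw [star_mul]; exact mul_mem hy hx

theorem field_mem_adjoin {S : Set H} {ξ : H} (hξ : ξ ∈ Submodule.span ℝ S) :
    field ξ ∈ Algebra.adjoin ℂ (field '' S : Set (CARPoly H)) := by
  induction hξ using Submodule.span_induction with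
  | mem ξ hξ => exact Algebra.subset_adjoin ⟨ξ, hξ, rfl⟩
  | zero => have h := field_real_smul (0 : ℝ) (0 : H); simp at h; rw [h]; exact zero_mem _
  | add ξ η _ _ h h' => rw [field_add]; exact add_mem h h'
  | smul r ξ _ h => rw [field_real_smul]; exact Subalgebra.smul_mem _ h _

/-- Adjoining one more field operator `Φ(ζ + ξ)`, with `ζ` in the span of `S` and `ξ` orthogonal to
it, to the algebra `P(S)` of polynomials in the `Φ(η)`, `η ∈ S`, gives at most `P(S) + Φ(ξ)P(S)`.
-/
theorem exists_add_field_mul {S : Set H} {ζ ξ : H} (hζ : ζ ∈ Submodule.span ℝ S)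
    (hξ : ∀ η ∈ Submodule.span ℝ S, (inner ℂ ξ η).re = 0) {x : CARPoly H}
    (hx : x ∈ Algebra.adjoin ℂ (field '' insert (ζ + ξ) S)) :
    ∃ y ∈ Algebra.adjoin ℂ (field '' S), ∃ z ∈ Algebra.adjoin ℂ (field '' S),
      x = y + field ξ * z := by
  -- the right-hand sides are stable under left multiplication by the generators
  suffices h : ∀ u ∈ Algebra.adjoin ℂ (field '' S), ∀ v ∈ Algebra.adjoin ℂ (field '' S),
      ∃ y ∈ Algebra.adjoin ℂ (field '' S), ∃ z ∈ Algebra.adjoin ℂ (field '' S),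
        x * (u + field ξ * v) = y + field ξ * z by
    simpa using h 1 (one_mem _) 0 (zero_mem _)
  induction hx using Algebra.adjoin_induction with
  | algebraMap r =>
    intro u hu v hv
    exact ⟨r • u, Subalgebra.smul_mem _ hu r, r • v, Subalgebra.smul_mem _ hv r, by
      rw [← Algebra.smul_def, smul_add, mul_smul_comm]⟩
  | add x x' _ _ hx hx' =>
    intro u hu v hv
    obtain ⟨y, hy, z, hz, h⟩ := hx u hu v hv
    obtain ⟨y', hy', z', hz', h'⟩ := hx' u hu v hv
    exact ⟨y + y', add_mem hy hy', z + z', add_mem hz hz', by rw [add_mul, h, h']; noncomm_ring⟩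
  | mul x x' _ _ hx hx' =>
    intro u hu v hv
    obtain ⟨y', hy', z', hz', h'⟩ := hx' u hu v hv
    obtain ⟨y, hy, z, hz, h⟩ := hx y' hy' z' hz'
    exact ⟨y, hy, z, hz, by rw [mul_assoc, h', h]⟩
  | mem x hx =>
    have key : ∀ η ∈ Submodule.span ℝ S, ∀ u v : CARPoly H,
        field η * (u + field ξ * v) = field η * u + field ξ * (-(field η * v)) := by
      intro η hη u v
      have h := field_mul_eq_neg (hξ η hη)
      rw [mul_add, ← mul_assoc, ← neg_neg (field η * field ξ), ← h]
      noncomm_ring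
    intro u hu v hv
    obtain ⟨η, rfl | hη, rfl⟩ := hx
    · refine ⟨field ζ * u + ((‖ξ‖ : ℂ) ^ 2) • v, add_mem (mul_mem (field_mem_adjoin hζ) hu)
        (Subalgebra.smul_mem _ hv _), -(field ζ * v) + u,
        add_mem (neg_mem (mul_mem (field_mem_adjoin hζ) hv)) hu, ?_⟩
      have h : field ξ * (u + field ξ * v) = field ξ * u + ((‖ξ‖ : ℂ) ^ 2) • v := by
        rw [mul_add, ← mul_assoc, field_mul_self, smul_mul_assoc, one_mul]
      rw [field_add, add_mul, key ζ hζ, h, mul_add]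
      abel
    · have hη' := Submodule.subset_span (R := ℝ) hη
      exact ⟨_, mul_mem (field_mem_adjoin hη') hu, _, neg_mem (mul_mem (field_mem_adjoin hη') hv),
        key η hη' u v⟩

/-- Positivity of the trace, by induction on the number of field operators: if `ξ` is orthogonal to
the previous vectors, then `y + Φ(ξ)z` has square norm `tr(y*y) + ‖ξ‖² tr(z*z)`. -/
theorem trace_star_mul_self_nonneg_of_mem (S : Finset H) (x : CARPoly H)
    (hx : x ∈ Algebra.adjoin ℂ (field '' (S : Set H))) : 0 ≤ trace H (star x * x) := by
  classical
  induction S using Finset.induction_on generalizing x with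
  | empty =>
    rw [Finset.coe_empty, Set.image_empty, Algebra.adjoin_empty] at hx
    obtain ⟨c, rfl⟩ := Algebra.mem_bot.mp hx
    rw [← algebraMap_star_comm, ← map_mul, Algebra.algebraMap_eq_smul_one, map_smul, trace_one,
      smul_eq_mul, mul_one]
    exact star_mul_self_nonneg c
  | insert ξ S _ ih =>
    let _ : InnerProductSpace ℝ H := InnerProductSpace.rclikeToReal ℂ H
    obtain ⟨ζ, hζ, η, hη, rfl⟩ :=
      (Submodule.span ℝ (S : Set H)).exists_add_mem_mem_orthogonal ξ
    have hη' : ∀ v ∈ Submodule.span ℝ (S : Set H), (inner ℂ η v).re = 0 := fun v hv =>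
      (Submodule.mem_orthogonal' _ _).mp hη v hv
    rw [Finset.coe_insert] at hx
    obtain ⟨y, hy, z, hz, rfl⟩ := exists_add_field_mul hζ hη' hx
    have hS : ∀ v ∈ (S : Set H), (inner ℂ η v).re = 0 := fun v hv =>
      hη' v (Submodule.subset_span hv)
    have h1 : trace H (star y * (field η * z)) = 0 := by
      rw [trace_mul_comm, mul_assoc]
      exact trace_field_mul_eq_zero hS (mul_mem hz (star_mem_adjoin hy))
    have h2 : trace H (star z * (field η * y)) = 0 := by
      rw [trace_mul_comm, mul_assoc]
      exact trace_field_mul_eq_zero hS (mul_mem hy (star_mem_adjoin hz))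
    have h3 : star (y + field η * z) * (y + field η * z) = star y * y + star y * (field η * z)
        + star z * (field η * y) + ((‖η‖ : ℂ) ^ 2) • (star z * z) := by
      have h4 : star z * (field η * (field η * z)) = ((‖η‖ : ℂ) ^ 2) • (star z * z) := by
        rw [← mul_assoc (field η), field_mul_self, smul_mul_assoc, one_mul, mul_smul_comm]
      rw [← h4, star_add, star_mul, star_field]
      noncomm_ring
    rw [h3, map_add, map_add, map_add, h1, h2, map_smul, add_zero, add_zero]
    refine add_nonneg (ih y hy) (mul_nonneg ?_ (ih z hz))
    exact_mod_cast sq_nonneg ‖η‖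

theorem trace_star_mul_self_nonneg (x : CARPoly H) : 0 ≤ trace H (star x * x) := by
  classical
  suffices h : ∃ S : Finset H, x ∈ Algebra.adjoin ℂ (field '' (S : Set H)) by
    obtain ⟨S, hS⟩ := h
    exact trace_star_mul_self_nonneg_of_mem S x hS
  have hmono : ∀ S T : Finset H, Algebra.adjoin ℂ (field '' (S : Set H) : Set (CARPoly H)) ≤
      Algebra.adjoin ℂ (field '' ((S ∪ T : Finset H) : Set H)) ∧
      Algebra.adjoin ℂ (field '' (T : Set H) : Set (CARPoly H)) ≤
      Algebra.adjoin ℂ (field '' ((S ∪ T : Finset H) : Set H)) := fun S T =>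
    ⟨Algebra.adjoin_mono (Set.image_mono (by simp)),
      Algebra.adjoin_mono (Set.image_mono (by simp))⟩
  have hx := mem_adjoin_range_field x
  induction hx using Algebra.adjoin_induction with
  | mem x hx => obtain ⟨ξ, rfl⟩ := hx; exact ⟨{ξ}, Algebra.subset_adjoin ⟨ξ, by simp, rfl⟩⟩
  | algebraMap r => exact ⟨∅, Subalgebra.algebraMap_mem _ _⟩
  | add x y _ _ hx hy =>
    obtain ⟨S, hS⟩ := hx
    obtain ⟨T, hT⟩ := hy
    exact ⟨S ∪ T, add_mem ((hmono S T).1 hS) ((hmono S T).2 hT)⟩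
  | mul x y _ _ hx hy =>
    obtain ⟨S, hS⟩ := hx
    obtain ⟨T, hT⟩ := hy
    exact ⟨S ∪ T, mul_mem ((hmono S T).1 hS) ((hmono S T).2 hT)⟩

end CARPoly

/-! ### Positive functionals on *-algebras -/

namespace PositiveFunctional

variable {P : Type*} [Ring P] [StarRing P] [Algebra ℂ P] [StarModule ℂ P] {ω : P →ₗ[ℂ] ℂ}

theorem conj_map_star_mul (hω : ∀ x, 0 ≤ ω (star x * x)) (x y : P) :
    (starRingEnd ℂ) (ω (star y * x)) = ω (star x * y) := by
  have him : ∀ z, (ω (star z * z)).im = 0 := fun z => ((Complex.le_def.mp (hω z)).2).symm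
  have h1 := him (x + y)
  have h2 := him (x + Complex.I • y)
  have e1 : star (x + y) * (x + y) = star x * x + star x * y + star y * x + star y * y := by
    rw [star_add]; noncomm_ring
  have e2 : star (x + Complex.I • y) * (x + Complex.I • y) =
      star x * x + Complex.I • (star x * y) - Complex.I • (star y * x) + star y * y := by
    simp only [star_add, star_smul, add_mul, mul_add, smul_mul_assoc, mul_smul_comm]
    match_scalars <;> simp
  rw [e1] at h1
  rw [e2] at h2
  simp only [map_add, map_sub, map_smul, Complex.add_im, Complex.sub_im, him, smul_eq_mul,
    Complex.mul_im, Complex.I_re, Complex.I_im] at h1 h2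
  apply Complex.ext
  · rw [Complex.conj_re]; linarith
  · rw [Complex.conj_im]; linarith

/-- The GNS inner product `⟨x, y⟩ = ω(x*y)`. -/
abbrev gnsCore (hω : ∀ x, 0 ≤ ω (star x * x)) : PreInnerProductSpace.Core ℂ P where
  inner x y := ω (star x * y)
  conj_inner_symm x y := conj_map_star_mul hω x y
  re_inner_nonneg x := (Complex.le_def.mp (hω x)).1
  add_left x y z := by rw [star_add, add_mul, map_add]
  smul_left x y r := by rw [star_smul, smul_mul_assoc, map_smul]; rfl

/-- The Cauchy–Schwarz inequality for positive functionals. -/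
theorem norm_map_star_mul_sq_le (hω : ∀ x, 0 ≤ ω (star x * x)) (x y : P) :
    ‖ω (star x * y)‖ ^ 2 ≤ (ω (star x * x)).re * (ω (star y * y)).re := by
  let := gnsCore hω
  have h := InnerProductSpace.Core.inner_mul_inner_self_le (𝕜 := ℂ) x y
  have h2 : ‖ω (star y * x)‖ = ‖ω (star x * y)‖ := by
    rw [← conj_map_star_mul hω x y, RCLike.norm_conj]
  change ‖ω (star x * y)‖ * ‖ω (star y * x)‖ ≤ _ at h
  rwa [h2, ← sq] at h

/-- A positive functional whose GNS representation is by bounded operators is dominated by a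
C*-seminorm, namely by the operator norm in this representation. -/
theorem exists_norm_le_cstarSeminorm (hω : ∀ x, 0 ≤ ω (star x * x))
    (hb : ∀ x, ∃ C, 0 ≤ C ∧ ∀ y,
      (ω (star (x * y) * (x * y))).re ≤ C ^ 2 * (ω (star y * y)).re) :
    ∃ p : CStarSeminorm P, ∀ x, ‖ω x‖ ≤ p.toSeminorm x * (ω 1).re := by
  let := gnsCore hω
  let : SeminormedAddCommGroup P := InnerProductSpace.Core.toSeminormedAddCommGroup (𝕜 := ℂ)
  let : InnerProductSpace ℂ P := InnerProductSpace.ofCore (gnsCore hω)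
  have hinner : ∀ x y : P, inner ℂ x y = ω (star x * y) := fun _ _ => rfl
  have hnorm : ∀ x : P, ‖x‖ ^ 2 = (ω (star x * x)).re := fun x => by
    rw [← hinner, norm_sq_eq_re_inner (𝕜 := ℂ)]; rfl
  have hbound : ∀ x : P, ∃ C, ∀ y : P, ‖LinearMap.mulLeft ℂ x y‖ ≤ C * ‖y‖ := fun x => by
    obtain ⟨C, hC0, hC⟩ := hb x
    refine ⟨C, fun y => le_of_sq_le_sq ?_ (mul_nonneg hC0 (norm_nonneg y))⟩
    rw [mul_pow, hnorm, hnorm]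
    exact hC y
  let L : P → P →L[ℂ] P := fun x => (LinearMap.mulLeft ℂ x).mkContinuousOfExistsBound (hbound x)
  have hL : ∀ x y, L x y = x * y := fun _ _ => rfl
  have hsq : ∀ x, ‖L x‖ ^ 2 ≤ ‖L (star x * x)‖ := fun x => by
    rw [← Real.le_sqrt (norm_nonneg _) (norm_nonneg _)]
    refine (L x).opNorm_le_bound (Real.sqrt_nonneg _) fun y => ?_
    refine le_of_sq_le_sq ?_ (mul_nonneg (Real.sqrt_nonneg _) (norm_nonneg y))
    rw [mul_pow, Real.sq_sqrt (norm_nonneg _), hL, hnorm]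
    calc (ω (star (x * y) * (x * y))).re = (inner ℂ y (L (star x * x) y)).re := by
          rw [hinner, hL, star_mul, mul_assoc, mul_assoc]
      _ ≤ ‖inner ℂ y (L (star x * x) y)‖ := Complex.re_le_norm _
      _ ≤ ‖y‖ * (‖L (star x * x)‖ * ‖y‖) :=
          (norm_inner_le_norm _ _).trans
            (mul_le_mul_of_nonneg_left ((L (star x * x)).le_opNorm y) (norm_nonneg y))
      _ = ‖L (star x * x)‖ * ‖y‖ ^ 2 := by ring
  have hmul : ∀ x y, ‖L (x * y)‖ ≤ ‖L x‖ * ‖L y‖ := fun x y => by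
    have h : L (x * y) = (L x).comp (L y) := by
      ext z
      simp [hL, mul_assoc]
    rw [h]
    exact (L x).opNorm_comp_le (L y)
  have hstar : ∀ x, ‖L x‖ ≤ ‖L (star x)‖ := fun x => by
    have h1 := hsq x
    have h2 := hmul (star x) x
    have h3 := norm_nonneg (L x)
    have h4 := norm_nonneg (L (star x))
    by_contra! hlt
    nlinarith
  let p : CStarSeminorm P :=
    { toFun := fun x => ‖L x‖
      map_zero' := by
        have h : L 0 = 0 := by ext z; simp [hL]
        rw [h, norm_zero]
      add_le' := fun x y => by
        have h : L (x + y) = L x + L y := by ext z; simp [hL, add_mul]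
        rw [h]
        exact norm_add_le _ _
      neg' := fun x => by
        have h : L (-x) = -L x := by ext z; simp [hL]
        rw [h, norm_neg]
      smul' := fun c x => by
        have h : L (c • x) = c • L x := by ext z; simp [hL]
        rw [h, norm_smul]
      mul_le' := hmul
      star_mul_self' := fun x => by
        refine le_antisymm ((hmul _ _).trans ?_) (hsq x)
        have h := hstar (star x)
        rw [star_star] at h
        rw [sq]
        exact mul_le_mul_of_nonneg_right h (norm_nonneg _) }
  refine ⟨p, fun x => ?_⟩
  calc ‖ω x‖ = ‖inner ℂ 1 (L x 1)‖ := by rw [hinner, hL, star_one, one_mul, mul_one]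
    _ ≤ ‖(1 : P)‖ * (‖L x‖ * ‖(1 : P)‖) :=
        (norm_inner_le_norm _ _).trans
          (mul_le_mul_of_nonneg_left ((L x).le_opNorm 1) (norm_nonneg _))
    _ = ‖L x‖ * ‖(1 : P)‖ ^ 2 := by ring
    _ = p.toSeminorm x * (ω 1).re := by rw [hnorm, star_one, one_mul]; rfl

end PositiveFunctional

section CStarAlgebra

variable {A : Type*} [CStarAlgebra A]

theorem IsTracialState.map_star_mul_self_re_le {ω : A →ₗ[ℂ] ℂ} (hω : IsTracialState ω) (x : A) :
    (ω (star x * x)).re ≤ ‖x‖ ^ 2 := by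
  let := CStarAlgebra.spectralOrder A
  have := CStarAlgebra.spectralOrderedRing A
  obtain ⟨y, hy⟩ := CStarAlgebra.nonneg_iff_eq_star_mul_self.mp
    (sub_nonneg.mpr (CStarAlgebra.star_mul_le_algebraMap_norm_sq (a := x)))
  have h := (Complex.le_def.mp (hω.nonneg y)).1
  have h1 : algebraMap ℝ A (‖x‖ ^ 2) = ((‖x‖ ^ 2 : ℝ) : ℂ) • (1 : A) := by
    rw [Algebra.algebraMap_eq_smul_one, Complex.coe_smul]
  rw [← hy, map_sub, h1, map_smul, hω.map_one, smul_eq_mul, mul_one, Complex.sub_re,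
    Complex.ofReal_re, Complex.zero_re] at h
  linarith

/-- Functionals dominated by a tracial state are bounded. -/
theorem IsDominatedBy.continuous {τ ω : A →ₗ[ℂ] ℂ} (hω : IsTracialState ω)
    (h : IsDominatedBy τ ω) : Continuous τ := by
  -- the domination inequality for `1` and `x`
  refine AddMonoidHomClass.continuous_of_bound τ 1 fun x => ?_
  have h1 := h 1 x
  rw [star_one, one_mul, one_mul, hω.map_one, Complex.one_re, one_mul] at h1
  rw [one_mul]
  exact le_of_sq_le_sq (h1.trans (hω.map_star_mul_self_re_le x)) (norm_nonneg x)

theorem IsTracialState.isDominatedBy_self {ω : A →ₗ[ℂ] ℂ} (hω : IsTracialState ω) :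
    IsDominatedBy ω ω :=
  PositiveFunctional.norm_map_star_mul_sq_le hω.nonneg

theorem IsTracialState.comp_starAlgEquiv {ω : A →ₗ[ℂ] ℂ} (hω : IsTracialState ω)
    (γ : A ≃⋆ₐ[ℂ] A) : IsTracialState (ω ∘ₗ (γ : A →⋆ₐ[ℂ] A).toAlgHom.toLinearMap) where
  map_one := by simpa using hω.map_one
  nonneg x := by simpa [map_star] using hω.nonneg (γ x)
  map_mul_comm x y := by simpa using hω.map_mul_comm (γ x) (γ y)

end CStarAlgebra

/-! ### The tracial state of the CAR algebra -/

variable {H : Type*} [NormedAddCommGroup H] [InnerProductSpace ℂ H]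

namespace CARPoly

/-- Left multiplication is bounded for the trace inner product, because `Φ(ξ)` acts as `‖ξ‖` times
an isometry. -/
theorem exists_trace_star_mul_self_le (x : CARPoly H) : ∃ C, 0 ≤ C ∧ ∀ y,
    (trace H (star (x * y) * (x * y))).re ≤ C ^ 2 * (trace H (star y * y)).re := by
  have hnn : ∀ y : CARPoly H, 0 ≤ (trace H (star y * y)).re := fun y =>
    (Complex.le_def.mp (trace_star_mul_self_nonneg y)).1
  induction mem_adjoin_range_field x using Algebra.adjoin_induction with
  | mem x hx =>
    obtain ⟨ξ, rfl⟩ := hx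
    refine ⟨‖ξ‖, norm_nonneg ξ, fun y => le_of_eq ?_⟩
    have h : star (field ξ * y) * (field ξ * y) = ((‖ξ‖ ^ 2 : ℝ) : ℂ) • (star y * y) := by
      rw [star_mul, star_field, mul_assoc, ← mul_assoc (field ξ), field_mul_self, smul_mul_assoc,
        one_mul, mul_smul_comm]
      push_cast
      rfl
    rw [h, map_smul, smul_eq_mul, Complex.re_ofReal_mul]
  | algebraMap c =>
    refine ⟨‖c‖, norm_nonneg c, fun y => le_of_eq ?_⟩
    have h : star (algebraMap ℂ (CARPoly H) c * y) * (algebraMap ℂ (CARPoly H) c * y)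
        = ((‖c‖ ^ 2 : ℝ) : ℂ) • (star y * y) := by
      rw [← Algebra.smul_def, star_smul, smul_mul_smul_comm]
      congr 1
      push_cast
      exact Complex.conj_mul' c
    rw [h, map_smul, smul_eq_mul, Complex.re_ofReal_mul]
  | mul x x' _ _ hx hx' =>
    obtain ⟨C, hC0, hC⟩ := hx
    obtain ⟨D, hD0, hD⟩ := hx'
    refine ⟨C * D, mul_nonneg hC0 hD0, fun y => ?_⟩
    rw [mul_assoc, mul_pow, mul_assoc]
    exact (hC _).trans (mul_le_mul_of_nonneg_left (hD y) (sq_nonneg C))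
  | add x x' _ _ hx hx' =>
    obtain ⟨C, hC0, hC⟩ := hx
    obtain ⟨D, hD0, hD⟩ := hx'
    refine ⟨2 * (C + D), by positivity, fun y => ?_⟩
    -- the parallelogram identity
    have h : star ((x + x') * y) * ((x + x') * y) + star ((x - x') * y) * ((x - x') * y)
        = (2 : ℂ) • (star (x * y) * (x * y)) + (2 : ℂ) • (star (x' * y) * (x' * y)) := by
      simp only [two_smul, star_mul, star_add, star_sub]
      noncomm_ring
    have h1 := congrArg (fun z => (trace H z).re) h
    simp only [map_add, two_smul, Complex.add_re] at h1
    have h2 := hnn ((x - x') * y)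
    have h3 := hnn y
    nlinarith [hC y, hD y, mul_nonneg (mul_nonneg hC0 hD0) h3, mul_nonneg (sq_nonneg C) h3,
      mul_nonneg (sq_nonneg D) h3]

theorem norm_trace_le (x : CARPoly H) : ‖trace H x‖ ≤ ‖x‖ := by
  obtain ⟨p, hp⟩ := PositiveFunctional.exists_norm_le_cstarSeminorm
    (ω := trace H) trace_star_mul_self_nonneg exists_trace_star_mul_self_le
  have h := hp x
  rw [trace_one, Complex.one_re, mul_one] at h
  exact h.trans (le_cstarSeminorm p x)

end CARPoly

namespace CAR

theorem exists_isTracialState : ∃ μ : CAR H →ₗ[ℂ] ℂ, IsTracialState μ := by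
  let t : CARPoly H →L[ℂ] ℂ := (CARPoly.trace H).mkContinuous 1 fun x => by
    simpa using CARPoly.norm_trace_le x
  let e : CARPoly H →L[ℂ] CAR H := ⟨ofPoly.toLinearMap, isometry_ofPoly.continuous⟩
  let μ : CAR H →L[ℂ] ℂ := t.extend e
  have hμ : ∀ x, μ (ofPoly x) = CARPoly.trace H x := fun x =>
    ContinuousLinearMap.extend_eq t (e := e) denseRange_ofPoly
      isometry_ofPoly.isUniformInducing x
  refine ⟨μ.toLinearMap, ?_, fun x => ?_, fun x y => ?_⟩
  · rw [← map_one (ofPoly (H := H))]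
    exact (hμ 1).trans CARPoly.trace_one
  · change 0 ≤ μ (star x * x)
    induction x using CAR.induction_on with
    | closed =>
      exact isClosed_le continuous_const
        (μ.continuous.comp (continuous_star.mul continuous_id))
    | ofPoly x =>
      rw [← ofPoly_star, ← map_mul, hμ]
      exact CARPoly.trace_star_mul_self_nonneg x
  · change μ (x * y) = μ (y * x)
    induction x using CAR.induction_on with
    | closed =>
      exact isClosed_eq (μ.continuous.comp (continuous_mul_const y))
        (μ.continuous.comp (continuous_const_mul y))
    | ofPoly x =>
      induction y using CAR.induction_on with
      | closed =>
        exact isClosed_eq (μ.continuous.comp (continuous_const_mul _))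
          (μ.continuous.comp (continuous_mul_const _))
      | ofPoly y => rw [← map_mul, ← map_mul, hμ, hμ, CARPoly.trace_mul_comm]

end CAR

namespace CAR

/-! ### Products of field operators -/

/-- The product `Φ(ξ₁) ⋯ Φ(ξₙ)` of field operators. -/
def fieldProd (L : List H) : CAR H := (L.map field).prod

theorem fieldProd_nil : fieldProd ([] : List H) = 1 := rfl

theorem fieldProd_cons (ξ : H) (L : List H) :
    fieldProd (ξ :: L) = field ξ * fieldProd L := List.prod_cons

theorem fieldProd_append (L L' : List H) :
    fieldProd (L ++ L') = fieldProd L * fieldProd L' := by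
  simp [fieldProd]

/-- The products of field operators span a dense subspace. -/
theorem eq_zero_of_forall_fieldProd {τ : CAR H →ₗ[ℂ] ℂ} (hc : Continuous τ)
    (h : ∀ L, τ (fieldProd L) = 0) : τ = 0 := by
  ext x
  change τ x = 0
  induction x using CAR.induction_on with
  | closed => exact isClosed_eq hc continuous_const
  | ofPoly x =>
    have hx := CARPoly.mem_adjoin_range_field x
    rw [← Subalgebra.mem_toSubmodule, Algebra.adjoin_eq_span] at hx
    induction hx using Submodule.span_induction with
    | zero => simp
    | add x y _ _ hx hy => rw [map_add, map_add, hx, hy, add_zero]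
    | smul c x _ hx => rw [map_smul, map_smul, hx, smul_zero]
    | mem x hx =>
      suffices hL : ∃ L, ofPoly x = fieldProd L by
        obtain ⟨L, hL⟩ := hL
        rw [hL, h]
      induction hx using Submonoid.closure_induction with
      | mem x hx => obtain ⟨ξ, rfl⟩ := hx; exact ⟨[ξ], by simp [fieldProd, field]⟩
      | one => exact ⟨[], by rw [map_one, fieldProd_nil]⟩
      | mul x y _ _ hx hy =>
        obtain ⟨L, hL⟩ := hx
        obtain ⟨L', hL'⟩ := hy
        exact ⟨L ++ L', by rw [map_mul, fieldProd_append, hL, hL']⟩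

theorem field_mul_eq_neg {ξ η : H} (h : (inner ℂ ξ η).re = 0) :
    field ξ * field η = -(field η * field ξ) := by
  rw [eq_neg_iff_add_eq_zero, field_mul_add_mul, h]
  simp

theorem field_mul_fieldProd {ξ : H} {L : List H} (h : ∀ η ∈ L, inner ℂ ξ η = 0) :
    field ξ * fieldProd L = (-1 : ℂ) ^ L.length • (fieldProd L * field ξ) := by
  induction L with
  | nil => simp [fieldProd_nil]
  | cons η L ih =>
    rw [List.forall_mem_cons] at h
    rw [fieldProd_cons, ← mul_assoc, field_mul_eq_neg (by rw [h.1, Complex.zero_re]), neg_mul,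
      mul_assoc, ih h.2, List.length_cons, pow_succ, mul_smul_comm, mul_neg_one, neg_smul, mul_assoc]

/-- Moving a field operator through a product of `n` field operators costs a sign `(-1)ⁿ` and
products of `n - 1` field operators. -/
theorem field_mul_fieldProd_sub_mem_span (ξ : H) (L : List H) :
    field ξ * fieldProd L - (-1 : ℂ) ^ L.length • (fieldProd L * field ξ) ∈
      Submodule.span ℂ (fieldProd '' {L' : List H | L'.length + 1 = L.length}) := by
  induction L with
  | nil => simp [fieldProd_nil]
  | cons η L ih =>
    have h : field ξ * fieldProd (η :: L)
        - (-1 : ℂ) ^ (η :: L).length • (fieldProd (η :: L) * field ξ)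
        = ((2 * (inner ℂ ξ η).re : ℝ) : ℂ) • fieldProd L
          - field η * (field ξ * fieldProd L - (-1 : ℂ) ^ L.length • (fieldProd L * field ξ)) := by
      have h1 := congrArg (· * fieldProd L) (field_mul_add_mul ξ η)
      simp only [add_mul, smul_mul_assoc, one_mul] at h1
      rw [← h1, fieldProd_cons, List.length_cons, pow_succ, mul_sub, mul_smul_comm, mul_assoc,
        mul_assoc, mul_assoc, mul_neg_one, neg_smul]
      abel
    rw [h]
    refine sub_mem (Submodule.smul_mem _ _ (Submodule.subset_span ⟨L, rfl, rfl⟩)) ?_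
    generalize field ξ * fieldProd L - (-1 : ℂ) ^ L.length • (fieldProd L * field ξ) = r at ih
    induction ih using Submodule.span_induction with
    | zero => rw [mul_zero]; exact zero_mem _
    | add x y _ _ hx hy => rw [mul_add]; exact add_mem hx hy
    | smul c x _ hx => rw [mul_smul_comm]; exact Submodule.smul_mem _ _ hx
    | mem x hx =>
      obtain ⟨L', hL', rfl⟩ := hx
      refine Submodule.subset_span ⟨η :: L', ?_, fieldProd_cons η L'⟩
      rw [Set.mem_ofPred_eq] at hL' ⊢
      rw [List.length_cons, List.length_cons, hL']

theorem exists_norm_eq_one_forall_inner_eq_zero {K : Submodule ℂ H}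
    (hK : ¬ FiniteDimensional ℂ K) (L : List H) :
    ∃ u ∈ K, ‖u‖ = 1 ∧ ∀ v ∈ L, inner ℂ u v = 0 := by
  let f : K →ₗ[ℂ] (Fin L.length → ℂ) :=
    LinearMap.pi fun i => (innerₛₗ ℂ (L.get i)) ∘ₗ K.subtype
  have hf : ∃ x, f x = 0 ∧ x ≠ 0 := by
    by_contra! hf
    exact hK (FiniteDimensional.of_injective f ((injective_iff_map_eq_zero f).mpr hf))
  obtain ⟨x, hx, hx0⟩ := hf
  have hx0' : (x : H) ≠ 0 := fun h => hx0 (Subtype.ext h)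
  refine ⟨((‖(x : H)‖⁻¹ : ℝ) : ℂ) • (x : H), K.smul_mem _ x.2, ?_, fun v hv => ?_⟩
  · rw [norm_smul, Complex.norm_real, norm_inv, norm_norm,
      inv_mul_cancel₀ (norm_ne_zero_iff.mpr hx0')]
  · obtain ⟨i, rfl⟩ := List.get_of_mem hv
    have h : inner ℂ (L.get i) (x : H) = 0 := congrFun hx i
    rw [inner_smul_left, inner_eq_zero_symm.mp h, mul_zero]

theorem field_mul_self_of_norm_eq_one {u : H} (hu : ‖u‖ = 1) : field u * field u = (1 : CAR H) := by
  rw [field_mul_self, hu]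
  simp

/-! ### Uniqueness of the tracial state -/

/-- A tracial functional vanishing at `1` vanishes on all products of field operators: on odd
products by anticommutation with a further vector, on even ones by cyclic permutation. -/
theorem map_fieldProd_eq_zero (hH : ¬ FiniteDimensional ℂ (⊤ : Submodule ℂ H))
    {d : CAR H →ₗ[ℂ] ℂ} (hd : ∀ x y, d (x * y) = d (y * x)) (hd1 : d 1 = 0) (L : List H) :
    d (fieldProd L) = 0 := by
  induction hn : L.length using Nat.strong_induction_on generalizing L with
  | _ n ih =>
  subst hn
  rcases Nat.even_or_odd L.length with hL | hL
  · cases L with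
    | nil => rw [fieldProd_nil, hd1]
    | cons ξ L =>
      have hL' : Odd L.length := by
        rw [List.length_cons] at hL
        exact Nat.not_even_iff_odd.mp (Nat.even_add_one.mp hL)
      have hspan : Submodule.span ℂ (fieldProd '' {L' : List H | L'.length + 1 = L.length})
          ≤ LinearMap.ker d := by
        rw [Submodule.span_le]
        rintro _ ⟨L', hL', rfl⟩
        rw [Set.mem_ofPred_eq] at hL'
        exact ih L'.length (by rw [List.length_cons]; omega) L' rfl
      have h := LinearMap.mem_ker.mp (hspan (field_mul_fieldProd_sub_mem_span ξ L))
      rw [hL'.neg_one_pow, neg_one_smul, sub_neg_eq_add, map_add, hd (fieldProd L)] at h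
      rw [fieldProd_cons]
      exact add_self_eq_zero.mp h
  · obtain ⟨u, -, hu1, hu⟩ := exists_norm_eq_one_forall_inner_eq_zero hH L
    have h := field_mul_fieldProd hu
    rw [hL.neg_one_pow, neg_one_smul] at h
    have h1 : d (fieldProd L) = -d (fieldProd L) :=
      calc d (fieldProd L) = d (field u * (field u * fieldProd L)) := by
            rw [← mul_assoc, field_mul_self_of_norm_eq_one hu1, one_mul]
        _ = -d (fieldProd L * field u * field u) := by rw [h, mul_neg, map_neg, hd]
        _ = -d (fieldProd L) := by rw [mul_assoc, field_mul_self_of_norm_eq_one hu1, mul_one]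
    exact self_eq_neg.mp h1

theorem isTracialState_unique (hH : ¬ FiniteDimensional ℂ (⊤ : Submodule ℂ H))
    {μ ν : CAR H →ₗ[ℂ] ℂ} (hμ : IsTracialState μ) (hν : IsTracialState ν) : μ = ν := by
  have hc : Continuous (μ - ν) := (hμ.isDominatedBy_self.continuous hμ).sub
    (hν.isDominatedBy_self.continuous hν)
  refine sub_eq_zero.mp (eq_zero_of_forall_fieldProd hc (map_fieldProd_eq_zero hH ?_ ?_))
  · intro x y
    rw [LinearMap.sub_apply, LinearMap.sub_apply, hμ.map_mul_comm, hν.map_mul_comm]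
  · rw [LinearMap.sub_apply, hμ.map_one, hν.map_one, sub_self]

/-! ### Twisted tracial functionals -/

section Twisted

variable [CompleteSpace H] (G : unitary (H →L[ℂ] H))

theorem grading_field (ξ : H) : grading G (field ξ) = field ((G : H →L[ℂ] H) ξ) := by
  rw [field_eq, field_eq, map_add, map_star, grading_a]

/-- For a unit vector `e`, the unitary `Φ(e)Φ(ie)` anticommutes with the field operators on `ℂe` and
commutes with those on its orthogonal complement. -/
theorem exists_unit_of_norm_eq_one {e : H} (he : ‖e‖ = 1) (hGe : (G : H →L[ℂ] H) e = e) :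
    ∃ Γ : (CAR H)ˣ, grading G Γ = Γ ∧
      (∀ c : ℂ, Γ * field (c • e) = -(field (c • e) * Γ)) ∧
      ∀ v, inner ℂ e v = 0 → Γ * field v = field v * Γ := by
  have he' : ‖Complex.I • e‖ = 1 := by rw [norm_smul, Complex.norm_I, he, one_mul]
  have h1 := field_mul_self_of_norm_eq_one he
  have h2 := field_mul_self_of_norm_eq_one he'
  have h3 : field e * field (Complex.I • e) = -(field (Complex.I • e) * field e) := by
    refine field_mul_eq_neg ?_
    rw [inner_smul_right, inner_self_eq_norm_sq_to_K, he]
    simp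
  refine ⟨⟨field e, field e, h1, h1⟩ * ⟨field (Complex.I • e), field (Complex.I • e), h2, h2⟩,
    ?_, fun c => ?_, fun v hv => ?_⟩
  · rw [Units.val_mul, map_mul, grading_field, grading_field, map_smul, hGe]
  · have hc : c • e = c.re • e + c.im • (Complex.I • e) := by
      conv_lhs => rw [← Complex.re_add_im c]
      rw [add_smul, mul_smul]; rfl
    rw [Units.val_mul, hc, field_add, field_real_smul, field_real_smul]
    generalize field e = p at *
    generalize field (Complex.I • e) = q at *
    have h4 : p * q * p = -(p * (p * q)) := by
      rw [mul_assoc, ← mul_neg, h3, neg_neg]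
    have h5 : p * q * q = -(q * (p * q)) := by
      nth_rewrite 1 [h3]
      rw [neg_mul, mul_assoc]
    change p * q * _ = -(_ * (p * q))
    rw [mul_add, add_mul, mul_smul_comm, mul_smul_comm, smul_mul_assoc, smul_mul_assoc, h4, h5]
    module
  · have h4 : field e * field v = -(field v * field e) :=
      field_mul_eq_neg (by rw [hv, Complex.zero_re])
    have h5 : field (Complex.I • e) * field v = -(field v * field (Complex.I • e)) :=
      field_mul_eq_neg (by rw [inner_smul_left, hv, mul_zero, Complex.zero_re])
    rw [Units.val_mul]
    change field e * field (Complex.I • e) * field v = field v * (field e * field (Complex.I • e))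
    rw [mul_assoc, h5, mul_neg, ← mul_assoc, h4, neg_mul, neg_neg, mul_assoc]

theorem exists_unit_of_orthonormal {ι : Type*} {e : ι → H} (he : Orthonormal ℂ e)
    (hGe : ∀ i, (G : H →L[ℂ] H) (e i) = e i) (s : Finset ι) :
    ∃ Γ : (CAR H)ˣ, grading G Γ = Γ ∧
      (∀ i ∈ s, ∀ c : ℂ, Γ * field (c • e i) = -(field (c • e i) * Γ)) ∧
      ∀ v, (∀ i ∈ s, inner ℂ (e i) v = 0) → Γ * field v = field v * Γ := by
  classical
  induction s using Finset.induction_on with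
  | empty => exact ⟨1, by simp, by simp, by simp⟩
  | insert i s hi ih =>
    obtain ⟨Γ, hΓ, hΓs, hΓv⟩ := ih
    obtain ⟨Δ, hΔ, hΔi, hΔv⟩ := exists_unit_of_norm_eq_one G (he.1 i) (hGe i)
    have horth : ∀ j ∈ s, i ≠ j := fun j hj h => hi (h ▸ hj)
    refine ⟨Γ * Δ, by rw [Units.val_mul, map_mul, hΓ, hΔ], fun j hj c => ?_, fun v hv => ?_⟩
    · rw [Units.val_mul, mul_assoc]
      rcases Finset.mem_insert.mp hj with rfl | hj
      · rw [hΔi, mul_neg, ← mul_assoc, hΓv _ fun k hk => ?_, mul_assoc]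
        rw [inner_smul_right, he.2 (horth k hk).symm, mul_zero]
      · rw [hΔv _ (by rw [inner_smul_right, he.2 (horth j hj), mul_zero]), ← mul_assoc,
          hΓs j hj, neg_mul, mul_assoc]
    · rw [Finset.forall_mem_insert] at hv
      rw [Units.val_mul, mul_assoc, hΔv v hv.1, ← mul_assoc, hΓv v hv.2, mul_assoc]

theorem apply_apply_of_isSelfAdjoint (hG : IsSelfAdjoint (G : H →L[ℂ] H)) (ξ : H) :
    (G : H →L[ℂ] H) ((G : H →L[ℂ] H) ξ) = ξ := by
  have h := (Unitary.mem_iff.mp G.2).1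
  rw [hG.star_eq] at h
  exact DFunLike.congr_fun h ξ

/-- On finitely many field operators, the automorphism `Φ(ξ) ↦ -Φ(Gξ)` is inner: it is implemented
by a product of fields that runs through an orthonormal basis of the span of their even parts. -/
theorem exists_unit_implementing (hG : IsSelfAdjoint (G : H →L[ℂ] H)) (L : List H) :
    ∃ Γ : (CAR H)ˣ, grading G Γ = Γ ∧
      ∀ v ∈ L, Γ * field v = -(field ((G : H →L[ℂ] H) v) * Γ) := by
  let g : H →L[ℂ] H := G
  have hgg : ∀ ξ, g (g ξ) = ξ := apply_apply_of_isSelfAdjoint G hG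
  let p : H → H := fun v => (1 / 2 : ℂ) • (v + g v)
  let W : Submodule ℂ H := Submodule.span ℂ (p '' {v | v ∈ L})
  have : FiniteDimensional ℂ W :=
    FiniteDimensional.span_of_finite ℂ ((List.finite_toSet L).image p)
  have hW : ∀ w ∈ W, g w = w := by
    intro w hw
    have hle : W ≤ LinearMap.eqLocus (g : H →ₗ[ℂ] H) LinearMap.id := by
      refine Submodule.span_le.mpr ?_
      rintro _ ⟨v, -, rfl⟩
      change g (p v) = p v
      rw [map_smul, map_add, hgg, add_comm]
    exact hle hw
  let e := stdOrthonormalBasis ℂ W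
  have he : Orthonormal ℂ fun i => (e i : H) := e.orthonormal.comp_linearIsometry W.subtypeₗᵢ
  obtain ⟨Γ, hΓ, hΓW, hΓv⟩ :=
    exists_unit_of_orthonormal G he (fun i => hW _ (e i).2) Finset.univ
  refine ⟨Γ, hΓ, fun v hv => ?_⟩
  have hp : Γ * field (p v) = -(field (p v) * Γ) := by
    have hpW : p v ∈ W := Submodule.subset_span ⟨v, hv, rfl⟩
    have hsum : p v = ∑ i, e.repr ⟨p v, hpW⟩ i • (e i : H) := by
      simpa using (congrArg Subtype.val (e.sum_repr ⟨p v, hpW⟩)).symm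
    rw [hsum]
    refine Finset.sum_induction _ (fun w : H => (Γ : CAR H) * field w = -(field w * (Γ : CAR H))) ?_ ?_
      fun i hi => hΓW i hi _
    · intro x y hx hy
      rw [field_add, mul_add, add_mul, hx, hy, neg_add]
    · have h0 : field (0 : H) = 0 := by simpa using field_real_smul 0 (0 : H)
      rw [h0, mul_zero, zero_mul, neg_zero]
  have hq : Γ * field (v - p v) = field (v - p v) * Γ := by
    refine hΓv _ fun i _ => ?_
    have h1 : g (v - p v) = -(v - p v) := by
      simp only [p, map_sub, map_smul, map_add, hgg]
      module
    have h2 : inner ℂ (e i : H) (g (v - p v)) = inner ℂ (g (e i)) (v - p v) :=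
      (hG.isSymmetric (e i : H) (v - p v)).symm
    rw [h1, hW _ (e i).2, inner_neg_right] at h2
    exact neg_eq_self.mp h2
  have hv1 : v = p v + (v - p v) := by abel
  have hv2 : g v = p v + -(v - p v) := by
    simp only [p]
    module
  change Γ * field v = -(field (g v) * Γ)
  rw [hv2, field_add, field_neg]
  nth_rewrite 1 [hv1]
  rw [field_add, mul_add, hp, hq]
  noncomm_ring

/-- A twisted tracial functional vanishes on all products of field operators. An even product `X`
commutes with `Φ(u)`, `u` an odd unit vector orthogonal to all vectors involved, and
`τ(Φ(u)²X) = -τ(XΦ(u)²)` by the twist. An odd product satisfies `ΓX = -γ(X)Γ` for a `γ`-invariant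
unit `Γ`, and `τ(Γ⁻¹γ(X)Γ) = τ(γ(X)) = τ(X)`. -/
theorem _root_.IsTwistedTracial.map_fieldProd_eq_zero
    (hG : IsSelfAdjoint (G : H →L[ℂ] H)) (hodd : ¬ FiniteDimensional ℂ
      (Module.End.eigenspace ((G : H →L[ℂ] H) : H →ₗ[ℂ] H) (-1)))
    {τ : CAR H →ₗ[ℂ] ℂ} (hτ : IsTwistedTracial (grading G) τ) (L : List H) :
    τ (fieldProd L) = 0 := by
  rcases Nat.even_or_odd L.length with hL | hL
  · obtain ⟨u, huG, hu1, hu⟩ := exists_norm_eq_one_forall_inner_eq_zero hodd L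
    have hu2 := field_mul_self_of_norm_eq_one hu1
    have hGu : (G : H →L[ℂ] H) u = -u := by
      have h := Module.End.mem_eigenspace_iff.mp huG
      rwa [neg_one_smul] at h
    have h := field_mul_fieldProd hu
    rw [hL.neg_one_pow, one_smul] at h
    have h1 : τ (fieldProd L) = -τ (fieldProd L) :=
      calc τ (fieldProd L) = τ (field u * (field u * fieldProd L)) := by
            rw [← mul_assoc, hu2, one_mul]
        _ = -τ (fieldProd L * (field u * field u)) := by
            rw [hτ, grading_field, hGu, field_neg, mul_neg, map_neg, h, mul_assoc]
        _ = -τ (fieldProd L) := by rw [hu2, mul_one]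
    exact self_eq_neg.mp h1
  · obtain ⟨Γ, hΓ, hΓL⟩ := exists_unit_implementing G hG L
    have hΓ' : grading G ↑Γ⁻¹ = ↑Γ⁻¹ := by
      have h := map_mul (grading G) (Γ : CAR H) ↑Γ⁻¹
      rw [Units.mul_inv, map_one, hΓ] at h
      exact Units.eq_inv_of_mul_eq_one_left h.symm
    have hcomm : ∀ L' : List H, (∀ v ∈ L', v ∈ L) →
        Γ * fieldProd L' = (-1 : ℂ) ^ L'.length • (grading G (fieldProd L') * Γ) := by
      intro L'
      induction L' with
      | nil => simp [fieldProd_nil]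
      | cons ξ L' ih =>
        intro hL'
        rw [List.forall_mem_cons] at hL'
        rw [fieldProd_cons, ← mul_assoc, hΓL ξ hL'.1, neg_mul, mul_assoc, ih hL'.2, map_mul,
          grading_field, List.length_cons, pow_succ, mul_smul_comm, mul_neg_one, neg_smul, mul_assoc]
    have hΓprod := hcomm L fun _ h => h
    rw [hL.neg_one_pow, neg_one_smul] at hΓprod
    have hinv : τ (grading G (fieldProd L)) = τ (fieldProd L) := by
      have h := hτ (fieldProd L) 1
      rwa [mul_one, one_mul, eq_comm] at h
    have h1 : τ (fieldProd L) = -τ (fieldProd L) :=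
      calc τ (fieldProd L) = τ (↑Γ⁻¹ * (Γ * fieldProd L)) := by
            rw [← mul_assoc, Units.inv_mul, one_mul]
        _ = -τ (grading G (fieldProd L) * (Γ * ↑Γ⁻¹)) := by
            rw [hτ, hΓprod, hΓ', neg_mul, map_neg, mul_assoc]
        _ = -τ (fieldProd L) := by rw [Units.mul_inv, mul_one, hinv]
    exact self_eq_neg.mp h1

end Twisted

end CAR

/-! ### Traces on the crossed product -/

namespace CrossedProduct

variable {A : Type*} [CStarAlgebra A] (γ : A ≃⋆ₐ[ℂ] A) (hγ : ∀ x, γ (γ x) = x)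

/-- The embedding `b ↦ (0, b)` as a linear map. -/
def inr : A →ₗ[ℂ] CrossedProduct γ hγ where
  toFun b := mk γ hγ 0 b
  map_add' b b' := by
    refine Subtype.ext (CStarMatrix.ext fun i j => ?_)
    change _ = (mk γ hγ 0 b : CStarMatrix (Fin 2) (Fin 2) A) i j +
      (mk γ hγ 0 b' : CStarMatrix (Fin 2) (Fin 2) A) i j
    fin_cases i <;> fin_cases j <;> simp [mk]
  map_smul' c b := by
    refine Subtype.ext (CStarMatrix.ext fun i j => ?_)
    change _ = c • (mk γ hγ 0 b : CStarMatrix (Fin 2) (Fin 2) A) i j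
    fin_cases i <;> fin_cases j <;> simp [mk]

theorem inr_apply (b : A) : inr γ hγ b = mk γ hγ 0 b := rfl

theorem mk_eq_add (a b : A) : mk γ hγ a b = mk γ hγ a 0 + inr γ hγ b := by
  refine Subtype.ext (CStarMatrix.ext fun i j => ?_)
  change _ = (mk γ hγ a 0 : CStarMatrix (Fin 2) (Fin 2) A) i j +
    (mk γ hγ 0 b : CStarMatrix (Fin 2) (Fin 2) A) i j
  fin_cases i <;> fin_cases j <;> simp [mk]

variable {γ hγ}

/-- The canonical extension of a `γ`-invariant tracial state is a tracial state. -/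
theorem isTracialState_comp_E {μ : A →ₗ[ℂ] ℂ} (hμ : IsTracialState μ) (hinv : ∀ x, μ (γ x) = μ x) :
    IsTracialState (μ ∘ₗ E γ hγ) where
  map_one := by rw [LinearMap.comp_apply, one_eq_mk, E_mk, hμ.map_one]
  nonneg x := by
    obtain ⟨a, b, rfl⟩ := exists_eq_mk γ hγ x
    rw [star_mk, mk_mul_mk, LinearMap.comp_apply, E_mk, map_add, ← map_mul, hinv]
    exact add_nonneg (hμ.nonneg a) (hμ.nonneg b)
  map_mul_comm x y := by
    obtain ⟨a, b, rfl⟩ := exists_eq_mk γ hγ x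
    obtain ⟨a', b', rfl⟩ := exists_eq_mk γ hγ y
    have h : μ (b * γ b') = μ (b' * γ b) := by
      rw [← hinv, map_mul, hγ, hμ.map_mul_comm]
    rw [mk_mul_mk, mk_mul_mk, LinearMap.comp_apply, LinearMap.comp_apply, E_mk, E_mk, map_add,
      map_add, hμ.map_mul_comm, h]

/-- The second component of a tracial state is twisted tracial. -/
theorem isTwistedTracial_comp_inr {ω : CrossedProduct γ hγ →ₗ[ℂ] ℂ} (hω : IsTracialState ω) :
    IsTwistedTracial γ (ω ∘ₗ inr γ hγ) := by
  intro x y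
  have h := hω.map_mul_comm (mk γ hγ x 0) (mk γ hγ 0 y)
  rw [mk_mul_mk, mk_mul_mk] at h
  simpa [inr_apply] using h

/-- The second component of a tracial state is dominated by the first one, by the Cauchy–Schwarz
inequality for `(x, 0)` and `(0, y)`. -/
theorem isDominatedBy_comp_inr {ω : CrossedProduct γ hγ →ₗ[ℂ] ℂ} (hω : IsTracialState ω)
    {μ : A →ₗ[ℂ] ℂ} (hinv : ∀ x, μ (γ x) = μ x) (hext : IsExtension γ hγ μ ω) :
    IsDominatedBy (ω ∘ₗ inr γ hγ) μ := by
  intro x y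
  have h := PositiveFunctional.norm_map_star_mul_sq_le hω.nonneg (mk γ hγ x 0) (mk γ hγ 0 y)
  simp only [star_mk, mk_mul_mk, star_zero, map_zero, mul_zero, zero_mul, add_zero, zero_add,
    hext _] at h
  rwa [← map_mul, hinv] at h

end CrossedProduct

end

theorem proposition3p5 {H : Type*} [NormedAddCommGroup H] [InnerProductSpace ℂ H] [CompleteSpace H]
    (G : unitary (H →L[ℂ] H)) (hG : IsSelfAdjoint (G : H →L[ℂ] H))
    (hodd : ¬ FiniteDimensional ℂ
      (Module.End.eigenspace ((G : H →L[ℂ] H) : H →ₗ[ℂ] H) (-1))) :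
    ∃ μ₀ : CAR H →ₗ[ℂ] ℂ,
      (∀ μ : CAR H →ₗ[ℂ] ℂ, IsTracialState μ ↔ μ = μ₀) ∧
      (∀ τ : CAR H →ₗ[ℂ] ℂ,
        (IsTwistedTracial (CAR.grading G) τ ∧ IsDominatedBy τ μ₀) ↔ τ = 0) ∧
      (∀ ω : CrossedProduct (CAR.grading G) (CAR.grading_grading G hG) →ₗ[ℂ] ℂ,
        (IsTracialState ω ∧ IsExtension (CAR.grading G) (CAR.grading_grading G hG) μ₀ ω) ↔
          ω = μ₀ ∘ₗ CrossedProduct.E (CAR.grading G) (CAR.grading_grading G hG)) := by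
  have hH : ¬ FiniteDimensional ℂ (⊤ : Submodule ℂ H) := fun h => hodd
    (FiniteDimensional.of_injective (Submodule.inclusion le_top) (Submodule.inclusion_injective _))
  obtain ⟨μ₀, hμ₀⟩ := CAR.exists_isTracialState (H := H)
  have hinv : ∀ x, μ₀ (CAR.grading G x) = μ₀ x := fun x =>
    DFunLike.congr_fun (CAR.isTracialState_unique hH (hμ₀.comp_starAlgEquiv (CAR.grading G)) hμ₀) x
  have htwisted : ∀ τ : CAR H →ₗ[ℂ] ℂ,
      IsTwistedTracial (CAR.grading G) τ → IsDominatedBy τ μ₀ → τ = 0 := fun τ hτ hdom =>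
    CAR.eq_zero_of_forall_fieldProd (hdom.continuous hμ₀) (hτ.map_fieldProd_eq_zero G hG hodd)
  refine ⟨μ₀, fun μ => ⟨fun hμ => CAR.isTracialState_unique hH hμ hμ₀, fun h => h ▸ hμ₀⟩,
    fun τ => ⟨fun h => htwisted τ h.1 h.2, ?_⟩, fun ω => ⟨fun h => ?_, ?_⟩⟩
  · rintro rfl
    refine ⟨fun x y => rfl, fun x y => ?_⟩
    rw [LinearMap.zero_apply, norm_zero, zero_pow two_ne_zero]
    exact mul_nonneg (Complex.le_def.mp (hμ₀.nonneg x)).1 (Complex.le_def.mp (hμ₀.nonneg y)).1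
  · have h0 := htwisted _ (CrossedProduct.isTwistedTracial_comp_inr h.1)
      (CrossedProduct.isDominatedBy_comp_inr h.1 hinv h.2)
    ext x
    obtain ⟨a, b, rfl⟩ := CrossedProduct.exists_eq_mk _ _ x
    have hb := DFunLike.congr_fun h0 b
    rw [LinearMap.comp_apply, LinearMap.zero_apply] at hb
    rw [CrossedProduct.mk_eq_add, map_add, h.2 a, hb, add_zero, ← CrossedProduct.mk_eq_add]
    rfl
  · rintro rfl
    exact ⟨CrossedProduct.isTracialState_comp_E hμ₀ hinv, fun a => rfl⟩
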